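/- Let $\Delta^{*n}$ be the punctured polydisk $\{0<|s_j|<1\}$, covered by the product $U^n$ of upper half planes via $s_j=e^{2\pi i z_j}$, and let $\mathcal V\to\Delta^{*n}$ be a variation of graded-polarized mixed Hodge structure with unipotent monodromy $T_1,\dots,T_n$ ($T_j$ being parallel translation along the counterclockwise loop in the variable $s_j$). Put $N_j=-\log T_j$. Let $V=V_{\mathbb Q}\otimes\mathbb C$ be the space of flat multivalued sections of $\mathcal V$ (identified with the central fibre of the canonical extension by $\sigma\mapsto e^{\sum_j z_jN_j}\sigma$), with its weight filtration $W$ and its forms $\mathcal S_k$ on $Gr^W_k$. Let $F(z)$, $z\in U^n$, be the period map of $\mathcal V$, and let $\psi$ be the untwisted period map, defined on $\Delta^{*n}$ by $F(z)=e^{\sum_j z_jN_j}.\psi(s)$. Assume that $\mathcal V$ is admissible: $\psi$ extends to a holomorphic map on $\Delta^n$ with values in the compact dual $\check{\mathcal M}$ of the classifying space, and, with $F_\infty=\psi(0)$, the data $(W,\mathcal S,F_\infty,N_1,\dots,N_n)$ are an infinitesimal mixed Hodge module, i.e. the $N_j$ are commuting nilpotent infinitesimal isometries with $N_jF^p_\infty\subseteq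 F^{p-1}_\infty$ and $N_jW_k\subseteq W_k$; on each $Gr^W_k$ the filtration induced by $e^{\sum_j z_jN_j}.F_\infty$ is a pure Hodge structure of weight $k$ polarized by $\mathcal S_k$ whenever all $\operatorname{Im}z_j$ are large enough; and for every $J\subseteq\{1,\dots,n\}$ the relative weight filtration ${}^rW(\sum_{j\in J}N_j,W)$ exists and is shifted by $-2$ by each $N_j$, $j\in J$. Let ${}^rW={}^rW(N_1+\dots+N_n,W)$, let $I^{p,q}$ be the Deligne bigrading of the limiting mixed Hodge structure $(F_\infty,{}^rW)$, and let $U^p_\infty=\bigoplus_q I^{p,q}$. Let $G_{\mathbb C}$ be the group of those $g\in GL(V)$ which preserve $W$ and induce isometries of the forms $\mathcal S_k$. Let $\wp_a$ be the space of those $\alpha\in Lie(G_{\mathbb C})$ with $\alpha(U^p_\infty)\subseteq U^{p+a}_\infty$ for all $p$, and let $q_\infty=\bigoplus_{a<0}\wp_a$. Let $0<r\le 1$ and let $\Gamma:\Delta^n_r\to q_\infty$ be holomorphic with $\Gamma(0)=0$ and $\psi(s)=e^{\Gamma(s)}.F_\infty$ on the polydisk $\Delta^n_r$ of radius $r$.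 Put $$\Omega=\frac1{2\pi i}\sum_{j=1}^n\frac{ds_j}{s_j}\otimes N_j,\qquad X(z)=\log\bigl(e^{\sum_j z_jN_j}e^{\Gamma(s)}\bigr),\quad s_j=e^{2\pi i z_j}.$$ Then on $\Delta^{*n}_r$ the 1-form $$e^{-\operatorname{ad}\Gamma}\,\Omega+e^{-\Gamma}\,\partial e^{\Gamma}$$ takes its values in $\wp_{-1}$. Moreover, let $\Gamma_{-1}$ and $X_{-1}$ be the components of $\Gamma$ and $X$ of degree $-1$ relative to the grading of $\mathfrak{gl}(V)$ by its subspaces of endomorphisms mapping $U^p_\infty$ into $U^{p+a}_\infty$ for all $p$ ($a\in\mathbb Z$). They take their values in $\wp_{-1}$, $\Gamma_{-1}$ is holomorphic on $\Delta^n_r$, and $$\partial X_{-1}=\Omega+\partial\Gamma_{-1}$$ (the right hand side being pulled back by $s_j=e^{2\pi iz_j}$). This 1-form is a Higgs field on the product bundle $V\times\Delta^{*n}_r\to\Delta^{*n}_r$: it is holomorphic and $$(\Omega+\partial\Gamma_{-1})\wedge(\Omega+\partial\Gamma_{-1})=0.$$ -/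

import Mathlib

open scoped TensorProduct

universe u

noncomputable section

/-! ### Rational vector spaces, complexification and filtrations -/

section LinearAlgebra

variable {H : Type u} [AddCommGroup H] [Module ℚ H]

/-- Complex conjugation `c ⊗ h ↦ c̄ ⊗ h` on `H_ℂ = ℂ ⊗ H`. -/
def conjC : (ℂ ⊗[ℚ] H) →ₛₗ[starRingEnd ℂ] (ℂ ⊗[ℚ] H) where
  toFun := LinearMap.rTensor H ((Complex.conjAe.toLinearMap).restrictScalars ℚ)
  map_add' := fun x y => map_add _ x y
  map_smul' := fun c x => by
    induction x using TensorProduct.induction_on with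
    | zero => simp
    | tmul a h => simp [TensorProduct.smul_tmul']
    | add x y hx hy => rw [smul_add, map_add, hx, hy, map_add, smul_add]

/-- The complex conjugate of a complex subspace of `H_ℂ`. -/
def conjSub (U : Submodule ℂ (ℂ ⊗[ℚ] H)) : Submodule ℂ (ℂ ⊗[ℚ] H) := U.comap conjC

/-- A finite increasing (weight) filtration, defined over `ℚ`. -/
structure IsWeightFiltration (W : ℤ → Submodule ℚ H) : Prop where
  mono : Monotone W
  eq_bot : ∃ k, W k = ⊥
  eq_top : ∃ k, W k = ⊤

/-- A finite decreasing (Hodge) filtration of `H_ℂ`. -/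
structure IsHodgeFiltration (F : ℤ → Submodule ℂ (ℂ ⊗[ℚ] H)) : Prop where
  anti : Antitone F
  eq_bot : ∃ p, F p = ⊥
  eq_top : ∃ p, F p = ⊤

/-- `Gr^W_k = W_k / W_{k-1}`. -/
abbrev Gr (W : ℤ → Submodule ℚ H) (k : ℤ) : Type u :=
  ↥(W k) ⧸ (W (k - 1)).submoduleOf (W k)

/-- The projection `W_k → Gr^W_k`. -/
abbrev toGr (W : ℤ → Submodule ℚ H) (k : ℤ) : ↥(W k) →ₗ[ℚ] Gr W k :=
  ((W (k - 1)).submoduleOf (W k)).mkQ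

/-- The inclusion `W_k ⊗ ℂ → H_ℂ`. -/
abbrev inclC (W : ℤ → Submodule ℚ H) (k : ℤ) : (ℂ ⊗[ℚ] ↥(W k)) →ₗ[ℂ] (ℂ ⊗[ℚ] H) :=
  (W k).subtype.baseChange ℂ

/-- The projection `W_k ⊗ ℂ → Gr^W_k ⊗ ℂ`. -/
abbrev toGrC (W : ℤ → Submodule ℚ H) (k : ℤ) : (ℂ ⊗[ℚ] ↥(W k)) →ₗ[ℂ] (ℂ ⊗[ℚ] Gr W k) :=
  (toGr W k).baseChange ℂ

/-- The filtration `F^p Gr^W_k = (F^p ∩ W_k + W_{k-1}) / W_{k-1}` of `Gr^W_k ⊗ ℂ`. -/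
def grF (W : ℤ → Submodule ℚ H) (F : ℤ → Submodule ℂ (ℂ ⊗[ℚ] H)) (k p : ℤ) :
    Submodule ℂ (ℂ ⊗[ℚ] Gr W k) :=
  ((F p).comap (inclC W k)).map (toGrC W k)

/-- The filtration `F` of `H_ℂ` is a pure Hodge structure of weight `k` polarized by `Q`. -/
structure IsPolarizedHodge (k : ℤ) (F : ℤ → Submodule ℂ (ℂ ⊗[ℚ] H))
    (Q : LinearMap.BilinForm ℚ H) : Prop where
  filtration : IsHodgeFiltration F
  opposed : ∀ p, IsCompl (F p) (conjSub (F (k + 1 - p)))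
  parity : ∀ u v, Q u v = (-1 : ℚ) ^ k * Q v u
  nondegenerate : Q.Nondegenerate
  /-- first Riemann bilinear relation -/
  orthogonal : ∀ p, ∀ u ∈ F p, ∀ v ∈ F (k + 1 - p), (Q.baseChange ℂ) u v = 0
  /-- second Riemann bilinear relation, on `H^{p,q} = F^p ∩ conj F^q`, `p + q = k` -/
  positive : ∀ p q, p + q = k → ∀ v ∈ F p ⊓ conjSub (F q), v ≠ 0 →
    0 < (Complex.I ^ (p - q) * (Q.baseChange ℂ) v (conjC v)).re

/-- `Lie(G_ℂ)`, where `G_ℂ` is the group of the `g ∈ GL(H_ℂ)` which preserve `W` and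
induce isometries of the forms `S_k` on `Gr^W_k`: the endomorphisms `α` preserving `W` (with
restriction `αk` to `W_k`) whose induced maps `Gr_k(α) = βk` are infinitesimal isometries. -/
def lieG (W : ℤ → Submodule ℚ H) (S : ∀ k, LinearMap.BilinForm ℚ (Gr W k)) :
    Submodule ℂ (Module.End ℂ (ℂ ⊗[ℚ] H)) where
  carrier := {α | ∀ k, ∃ (αk : Module.End ℂ (ℂ ⊗[ℚ] ↥(W k)))
      (βk : Module.End ℂ (ℂ ⊗[ℚ] Gr W k)),
      (∀ x, α (inclC W k x) = inclC W k (αk x)) ∧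
      (∀ x, toGrC W k (αk x) = βk (toGrC W k x)) ∧
      ∀ u v, ((S k).baseChange ℂ) (βk u) v + ((S k).baseChange ℂ) u (βk v) = 0}
  zero_mem' := fun k => ⟨0, 0, by simp, by simp, by simp⟩
  add_mem' := by
    intro α α' h h' k
    obtain ⟨a, b, h1, h2, h3⟩ := h k
    obtain ⟨a', b', h1', h2', h3'⟩ := h' k
    refine ⟨a + a', b + b', fun x => by simp only [LinearMap.add_apply, map_add, h1, h1'],
      fun x => by simp only [LinearMap.add_apply, map_add, h2, h2'], fun u v => ?_⟩
    have e := h3 u v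
    have e' := h3' u v
    simp only [LinearMap.add_apply, map_add]
    linear_combination e + e'
  smul_mem' := by
    intro c α h k
    obtain ⟨a, b, h1, h2, h3⟩ := h k
    refine ⟨c • a, c • b, fun x => by simp only [LinearMap.smul_apply, map_smul, h1],
      fun x => by simp only [LinearMap.smul_apply, map_smul, h2], fun u v => ?_⟩
    have e := h3 u v
    simp only [LinearMap.smul_apply, map_smul, smul_eq_mul]
    linear_combination c * e

/-! ### Monodromy weight filtrations -/

/-- `M` is the monodromy weight filtration `W(N)` of the nilpotent endomorphism `N`:
`N M_j ⊆ M_{j-2}` and `N^l : Gr^M_l → Gr^M_{-l}` is an isomorphism for all `l ≥ 0`. -/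
structure IsMonodromyWeight (N : Module.End ℚ H) (M : ℤ → Submodule ℚ H) : Prop where
  filtration : IsWeightFiltration M
  shift : ∀ j, (M j).map N ≤ M (j - 2)
  injective : ∀ l : ℕ, ∀ x ∈ M l, (N ^ l) x ∈ M (-(l : ℤ) - 1) → x ∈ M ((l : ℤ) - 1)
  surjective : ∀ l : ℕ, ∀ y ∈ M (-(l : ℤ)), ∃ x ∈ M l, (N ^ l) x - y ∈ M (-(l : ℤ) - 1)

/-- `M` is the relative weight filtration `ʳW(N, W)`: `N M_j ⊆ M_{j-2}`, and on each `Gr^W_k`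
the filtration `M` induces the shifted filtration `W(N : Gr^W_k → Gr^W_k)[-k]`, whose
`j`-th term is `W(N : Gr^W_k → Gr^W_k)_{j-k}`. -/
structure IsRelativeWeight (N : Module.End ℚ H) (W M : ℤ → Submodule ℚ H) : Prop where
  filtration : IsWeightFiltration M
  shift : ∀ j, (M j).map N ≤ M (j - 2)
  graded : ∀ k, ∃ Nk : Module.End ℚ (Gr W k),
    (∀ x x' : ↥(W k), N x = x' → Nk (toGr W k x) = toGr W k x') ∧
    IsMonodromyWeight Nk (fun j => ((M (j + k)).submoduleOf (W k)).map (toGr W k))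

open Classical in
/-- The relative weight filtration `ʳW(N, W)` (it is unique when it exists). -/
def relativeWeight (N : Module.End ℚ H) (W : ℤ → Submodule ℚ H) : ℤ → Submodule ℚ H :=
  if h : ∃ M, IsRelativeWeight N W M then h.choose else fun _ => ⊥

/-! ### The Deligne bigrading and the induced grading of `Lie(G_ℂ)` -/

/-- `I` is the Deligne bigrading of `(F, W)`: `H_ℂ = ⨁ I^{p,q}`, `F^p = ⨁_{r ≥ p} I^{r,s}`,
`W_k = ⨁_{r + s ≤ k} I^{r,s}` and `I^{p,q} = conj I^{q,p}` modulo `⨁_{r < p, s < q} I^{r,s}`. -/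
structure IsDeligneBigrading (F : ℤ → Submodule ℂ (ℂ ⊗[ℚ] H)) (W : ℤ → Submodule ℚ H)
    (I : ℤ → ℤ → Submodule ℂ (ℂ ⊗[ℚ] H)) : Prop where
  internal : DirectSum.IsInternal (fun pq : ℤ × ℤ => I pq.1 pq.2)
  hodge : ∀ p, F p = ⨆ (r : ℤ) (_ : p ≤ r) (s : ℤ), I r s
  weight : ∀ k, (W k).baseChange ℂ = ⨆ (r : ℤ) (s : ℤ) (_ : r + s ≤ k), I r s
  conj : ∀ p q, I p q ⊔ (⨆ (r : ℤ) (_ : r < p) (s : ℤ) (_ : s < q), I r s) =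
    conjSub (I q p) ⊔ (⨆ (r : ℤ) (_ : r < p) (s : ℤ) (_ : s < q), I r s)

open Classical in
/-- The subspaces `I^{p,q}_{(F,W)}` of the mixed Hodge structure `(F, W)`: its Deligne
bigrading, which is unique. (Value `⊥` if `(F, W)` is not a mixed Hodge structure.) -/
def deligneBigrading (F : ℤ → Submodule ℂ (ℂ ⊗[ℚ] H)) (W : ℤ → Submodule ℚ H) :
    ℤ → ℤ → Submodule ℂ (ℂ ⊗[ℚ] H) :=
  if h : ∃ I, IsDeligneBigrading F W I then h.choose else fun _ _ => ⊥

/-- `U^p = ⨁_q I^{p,q}_{(F,W)}`. -/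
def hodgeU (F : ℤ → Submodule ℂ (ℂ ⊗[ℚ] H)) (W : ℤ → Submodule ℚ H) (p : ℤ) :
    Submodule ℂ (ℂ ⊗[ℚ] H) :=
  ⨆ q, deligneBigrading F W p q

/-- `gl(V)_a`: the endomorphisms mapping `U^p` into `U^{p+a}` for all `p`. -/
def glGraded {V : Type u} [AddCommGroup V] [Module ℂ V] (U : ℤ → Submodule ℂ V) (a : ℤ) :
    Submodule ℂ (Module.End ℂ V) where
  carrier := {α | ∀ p, ∀ x ∈ U p, α x ∈ U (p + a)}
  zero_mem' := fun p x _ => by simp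
  add_mem' := fun h h' p x hx => by
    simpa using (U _).add_mem (h p x hx) (h' p x hx)
  smul_mem' := fun c α h p x hx => by
    simpa using (U _).smul_mem c (h p x hx)

/-- `β` is the component of degree `a` of `α` relative to `gl(V) = ⨁_b gl(V)_b`. -/
def IsComponent {V : Type u} [AddCommGroup V] [Module ℂ V] (U : ℤ → Submodule ℂ V) (a : ℤ)
    (α β : Module.End ℂ V) : Prop :=
  ∃ d : ℤ →₀ Module.End ℂ V, (∀ b, d b ∈ glGraded U b) ∧ (d.sum fun _ x => x) = α ∧ d a = β

/-- `ad γ : α ↦ γα - αγ` on `gl(V)`. -/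
def adEnd {V : Type u} [AddCommGroup V] [Module ℂ V] (γ : Module.End ℂ V) :
    Module.End ℂ (Module.End ℂ V) :=
  LinearMap.mulLeft ℂ γ - LinearMap.mulRight ℂ γ

/-- The component is unique when `V = ⨁ U^p`. -/
lemma IsComponent.unique {V : Type u} [AddCommGroup V] [Module ℂ V] {U : ℤ → Submodule ℂ V}
    (hU : DirectSum.IsInternal U) {a : ℤ} {α β β' : Module.End ℂ V}
    (h : IsComponent U a α β) (h' : IsComponent U a α β') : β = β' := by
  obtain ⟨d, hd, hs, rfl⟩ := h
  obtain ⟨d', hd', hs', rfl⟩ := h'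
  have key : ∀ p, ∀ x ∈ U p, d a x = d' a x := by
    intro p x hx
    have e : ∀ c : ℤ →₀ Module.End ℂ V, c.sum (fun _ y => y) = α →
        ∑ b ∈ d.support ∪ d'.support ∪ c.support, c b x = α x := by
      intro c hc
      rw [← hc, Finsupp.sum, LinearMap.sum_apply]
      refine (Finset.sum_subset Finset.subset_union_right ?_).symm
      intro b _ hb
      simp [Finsupp.notMem_support_iff.1 hb]
    have e1 := e d hs
    have e2 := e d' hs'
    have s1 : d.support ∪ d'.support ∪ d.support = d.support ∪ d'.support := by
      ext; simp; tauto
    have s2 : d.support ∪ d'.support ∪ d'.support = d.support ∪ d'.support := by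
      ext; simp
    rw [s1] at e1
    rw [s2] at e2
    have e3 : ∑ b ∈ d.support ∪ d'.support, (d b x - d' b x) = 0 := by
      rw [Finset.sum_sub_distrib, e1, e2, sub_self]
    have hind : iSupIndep fun b => U (p + b) :=
      hU.submodule_iSupIndep.comp (add_right_injective p)
    by_cases ha : a ∈ d.support ∪ d'.support
    · have hmem : ∀ b ∈ d.support ∪ d'.support, d b x - d' b x ∈ U (p + b) := fun b _ =>
        (U _).sub_mem (hd b p x hx) (hd' b p x hx)
      exact sub_eq_zero.1
        ((iSupIndep_iff_finsetSum_eq_zero_imp_eq_zero _).1 hind _ _ hmem e3 a ha)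
    · simp only [Finset.mem_union, not_or, Finsupp.notMem_support_iff] at ha
      simp [ha.1, ha.2]
  have top : (⊤ : Submodule ℂ V) ≤ LinearMap.eqLocus (d a) (d' a) := by
    rw [← hU.submodule_iSup_eq_top]
    exact iSup_le fun p x hx => key p x hx
  exact LinearMap.ext fun x => top (Submodule.mem_top : x ∈ ⊤)

/-- The logarithm `∑_{k ≥ 1} (-1)^{k+1} (g - 1)^k / k` of a unipotent endomorphism of a
finite dimensional vector space (the terms with `k > dim V` vanish). -/
def unipotentLog {K : Type*} [Field K] {V : Type u} [AddCommGroup V] [Module K V]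
    (g : Module.End K V) : Module.End K V :=
  ∑ k ∈ Finset.range (Module.finrank K V), ((-1 : K) ^ k / ((k : K) + 1)) • (g - 1) ^ (k + 1)

end LinearAlgebra

/-! ### Holomorphic maps into finite dimensional vector spaces, filtrations on open sets -/

section Holomorphic

variable {n : ℕ} {V : Type u} [AddCommGroup V] [Module ℂ V]

/-- A map from an open subset of `ℂⁿ` to a finite dimensional complex vector space (without
a chosen norm) is holomorphic if its coordinates are. -/
def IsHol (O : Set (Fin n → ℂ)) (f : (Fin n → ℂ) → V) : Prop :=
  ∀ l : Module.Dual ℂ V, DifferentiableOn ℂ (fun z => l (f z)) O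

/-- `w` is the partial derivative `∂f/∂z_j` at `z`. -/
def HasPartial (j : Fin n) (f : (Fin n → ℂ) → V) (z : Fin n → ℂ) (w : V) : Prop :=
  ∀ l : Module.Dual ℂ V, HasDerivAt (fun t => l (f (Function.update z j t))) (l w) (z j)

/-- The subspaces `F^p(z)`, `z ∈ O`, form holomorphic subbundles of `V × O`: locally, they have
holomorphic frames. -/
def IsHolomorphicFiltration {O : Set (Fin n → ℂ)} (F : ℤ → ↥O → Submodule ℂ V) : Prop :=
  ∀ (p : ℤ) (z₀ : ↥O), ∃ B : Set (Fin n → ℂ), IsOpen B ∧ ↑z₀ ∈ B ∧ B ⊆ O ∧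
    ∃ (d : ℕ) (e : Fin d → (Fin n → ℂ) → V), (∀ i, IsHol B (e i)) ∧
      ∀ z : ↥O, ↑z ∈ B → LinearIndependent ℂ (fun i => e i z) ∧
        Submodule.span ℂ (Set.range fun i => e i z) = F p z

/-- Griffiths horizontality: first derivatives of local holomorphic sections of `F^p` are
sections of `F^{p-1}`. -/
def IsHorizontal {O : Set (Fin n → ℂ)} (F : ℤ → ↥O → Submodule ℂ V) : Prop :=
  ∀ (p : ℤ) (B : Set (Fin n → ℂ)), IsOpen B → B ⊆ O → ∀ v : (Fin n → ℂ) → V, IsHol B v →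
    (∀ z : ↥O, ↑z ∈ B → v z ∈ F p z) →
      ∀ z : ↥O, ↑z ∈ B → ∀ (j : Fin n) (w : V), HasPartial j v z w → w ∈ F (p - 1) z

/-- The matrix valued 1-form `θ = ∑ θ_j ds_j` is a Higgs field on the product bundle
`V × O`: it is holomorphic and `θ ∧ θ = 0`, that is, `[θ_i, θ_j] = 0`. -/
def IsHiggsField (O : Set (Fin n → ℂ)) (θ : Fin n → (Fin n → ℂ) → Module.End ℂ V) : Prop :=
  (∀ j, IsHol O (θ j)) ∧ ∀ s ∈ O, ∀ i j, θ i s * θ j s - θ j s * θ i s = 0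

end Holomorphic

/-! ### The punctured polydisk and its universal covering -/

/-- The polydisk `Δⁿ_r`. -/
def polydisk (n : ℕ) (r : ℝ) : Set (Fin n → ℂ) := {s | ∀ j, ‖s j‖ < r}

/-- The punctured polydisk `Δ*ⁿ_r`. -/
def puncturedPolydisk (n : ℕ) (r : ℝ) : Set (Fin n → ℂ) := {s | ∀ j, s j ≠ 0 ∧ ‖s j‖ < r}

/-- The product `Uⁿ` of `n` upper half planes. -/
def upperHalf (n : ℕ) : Set (Fin n → ℂ) := {z | ∀ j, 0 < (z j).im}

/-- `s_j = e^{2πi z_j}`. -/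
def expMap {n : ℕ} (z : Fin n → ℂ) : Fin n → ℂ :=
  fun j => Complex.exp (2 * Real.pi * Complex.I * z j)

lemma norm_expMap {n : ℕ} (z : Fin n → ℂ) (j : Fin n) :
    ‖expMap z j‖ = Real.exp (-(2 * Real.pi * (z j).im)) := by
  simp [expMap, Complex.norm_exp]

lemma expMap_mem {n : ℕ} {z : Fin n → ℂ} (hz : z ∈ upperHalf n) :
    expMap z ∈ puncturedPolydisk n 1 := by
  intro j
  refine ⟨Complex.exp_ne_zero _, ?_⟩
  rw [norm_expMap, Real.exp_lt_one_iff]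
  have := mul_pos Real.two_pi_pos (hz j)
  linarith

/-- The covering map `Uⁿ → Δ*ⁿ`. -/
def cover {n : ℕ} (z : ↥(upperHalf n)) : ↥(puncturedPolydisk n 1) := ⟨expMap z, expMap_mem z.2⟩

lemma upperHalf_segment {n : ℕ} {z w : Fin n → ℂ} (hz : z ∈ upperHalf n) (hw : w ∈ upperHalf n)
    (t : unitInterval) : AffineMap.lineMap z w (t : ℂ) ∈ upperHalf n := by
  intro j
  have h : ((AffineMap.lineMap z w (t : ℂ) : Fin n → ℂ) j).im
      = (1 - (t : ℝ)) * (z j).im + (t : ℝ) * (w j).im := by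
    simp [AffineMap.lineMap_apply]
    ring
  rw [h]
  rcases eq_or_lt_of_le t.2.1 with h0 | h0
  · rw [← h0]; simpa using hz j
  · have h1 := mul_pos h0 (hw j)
    have h2 := mul_nonneg (sub_nonneg.2 t.2.2) (hz j).le
    linarith

/-- The path in `Δ*ⁿ` which is the image of the straight segment from `z` to `w` in `Uⁿ`. -/
def coverPath {n : ℕ} (z w : ↥(upperHalf n)) : Path (cover z) (cover w) where
  toFun t := cover ⟨AffineMap.lineMap (z : Fin n → ℂ) w ((t : ℝ) : ℂ), upperHalf_segment z.2 w.2 t⟩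
  continuous_toFun := by
    refine Continuous.subtype_mk ?_ _
    refine continuous_pi fun j => ?_
    simp only [expMap, AffineMap.lineMap_apply]
    fun_prop
  source' := by simp [cover]
  target' := by simp [cover]

/-- The counterclockwise loop `γ_j(t) = (s_1, …, e^{2πit} s_j, …, s_n)`. -/
def loop {n : ℕ} (s : ↥(puncturedPolydisk n 1)) (j : Fin n) : Path s s where
  toFun t := ⟨Function.update (s : Fin n → ℂ) j
      (Complex.exp (2 * Real.pi * Complex.I * (t : ℝ)) * (s : Fin n → ℂ) j), by
    intro i
    by_cases h : i = j
    · subst h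
      refine ⟨by simpa using (s.2 i).1, ?_⟩
      have : ‖Complex.exp (2 * Real.pi * Complex.I * (t : ℝ))‖ = 1 := by
        simp [Complex.norm_exp]
      simpa [this] using (s.2 i).2
    · simpa [Function.update_of_ne h] using s.2 i⟩
  continuous_toFun := by
    refine Continuous.subtype_mk ?_ _
    refine Continuous.update continuous_const j ?_
    fun_prop
  source' := by simp
  target' := by simp [Complex.exp_two_pi_mul_I]

/-- The base point `(i, …, i)` of `Uⁿ`. -/
def baseU (n : ℕ) : ↥(upperHalf n) := ⟨fun _ => Complex.I, fun _ => by simp⟩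

/-! ### Variations of graded-polarized mixed Hodge structure over `Δ*ⁿ` -/

open CategoryTheory

/-- A local system of `ℚ`-vector spaces on a space `X`: a representation of its
fundamental groupoid, by parallel translation. -/
abbrev LocalSystem (X : Type) [TopologicalSpace X] := FundamentalGroupoid X ⥤ ModuleCat.{u} ℚ

namespace LocalSystem

/-- The fibre at `x`. -/
abbrev fibre {X : Type} [TopologicalSpace X] (L : LocalSystem.{u} X) (x : X) : Type u :=
  L.obj (FundamentalGroupoid.mk x)

/-- Parallel translation along a path. -/
def transport {X : Type} [TopologicalSpace X] (L : LocalSystem.{u} X) {x y : X} (γ : Path x y) :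
    L.fibre x →ₗ[ℚ] L.fibre y :=
  (L.map (FundamentalGroupoid.fromPath (Path.Homotopic.Quotient.mk γ))).hom

/-- The space `V_ℚ` of flat multivalued sections over `Δ*ⁿ`, that is, of flat sections of the
pull back to the universal covering `Uⁿ`; a section is identified with its value at the
base point. The choice of the coordinates `s_j` identifies `V_ℚ` with the rational structure of
the central fibre of the canonical extension, via the single valued sections
`σᶜ = e^{∑ z_j N_j} σ`. -/
abbrev VQ {n : ℕ} (L : LocalSystem.{u} ↥(puncturedPolydisk n 1)) : Type u :=
  L.fibre (cover (baseU n))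

/-- `V = V_ℚ ⊗ ℂ`. -/
abbrev VC {n : ℕ} (L : LocalSystem.{u} ↥(puncturedPolydisk n 1)) : Type u := ℂ ⊗[ℚ] L.VQ

/-- Parallel translation to `V` of a family of subspaces of the fibres: the subspace of the
`σ ∈ V` whose value at `z` lies in the given subspace over `e^{2πiz}`. -/
def develop {n : ℕ} (L : LocalSystem.{u} ↥(puncturedPolydisk n 1))
    (F : ∀ s, ℤ → Submodule ℂ (ℂ ⊗[ℚ] L.fibre s)) (p : ℤ) (z : ↥(upperHalf n)) :
    Submodule ℂ L.VC :=
  (F (cover z) p).map ((L.transport (coverPath z (baseU n))).baseChange ℂ)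

end LocalSystem

/-- A variation of graded-polarized mixed Hodge structure over `Δ*ⁿ`. Holomorphy and
horizontality are local conditions, expressed on the universal covering `Uⁿ`, where parallel
translation trivializes the local system. -/
structure VGPMHS (n : ℕ) where
  /-- the local system `𝒱_ℚ` -/
  L : LocalSystem.{u} ↥(puncturedPolydisk n 1)
  finite : ∀ s, Module.Finite ℚ (L.fibre s)
  /-- the weight filtration, by sub-local systems -/
  W : ∀ s, ℤ → Submodule ℚ (L.fibre s)
  weight_filtration : ∀ s, IsWeightFiltration (W s)
  weight_flat : ∀ {s t} (γ : Path s t) (k), (W s k).map (L.transport γ) ≤ W t k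
  /-- the Hodge filtration -/
  F : ∀ s, ℤ → Submodule ℂ (ℂ ⊗[ℚ] L.fibre s)
  hodge_filtration : ∀ s, IsHodgeFiltration (F s)
  hodge_holomorphic : IsHolomorphicFiltration (L.develop F)
  hodge_horizontal : IsHorizontal (L.develop F)
  /-- the flat bilinear forms on `Gr^W_k` -/
  S : ∀ s k, LinearMap.BilinForm ℚ (Gr (W s) k)
  form_flat : ∀ {s t} (γ : Path s t) (k) (u v : ↥(W s k)) (u' v' : ↥(W t k)),
    L.transport γ u = u' → L.transport γ v = v' →
      S t k (toGr (W t) k u') (toGr (W t) k v') = S s k (toGr (W s) k u) (toGr (W s) k v)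
  /-- `F Gr^W_k` is a variation of pure Hodge structure of weight `k` polarized by `S_k` -/
  graded_polarized : ∀ s k, IsPolarizedHodge k (grF (W s) (F s) k) (S s k)
  graded_holomorphic : ∀ k, IsHolomorphicFiltration
    (fun p z => grF (W (cover (baseU n))) (fun p => L.develop F p z) k p)
  graded_horizontal : ∀ k, IsHorizontal
    (fun p z => grF (W (cover (baseU n))) (fun p => L.develop F p z) k p)

namespace VGPMHS

variable {n : ℕ} (𝒱 : VGPMHS.{u} n)

/-- The rational vector space `V_ℚ`. -/
abbrev VQ : Type u := 𝒱.L.VQ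

/-- The complex vector space `V = V_ℚ ⊗ ℂ`. -/
abbrev V : Type u := 𝒱.L.VC

/-- The weight filtration of `V_ℚ`. -/
abbrev WV : ℤ → Submodule ℚ 𝒱.VQ := 𝒱.W (cover (baseU n))

/-- The bilinear forms on `Gr^W_k V_ℚ`. -/
abbrev SV : ∀ k, LinearMap.BilinForm ℚ (Gr 𝒱.WV k) := 𝒱.S (cover (baseU n))

/-- The period map `F(z)` on `Uⁿ`. -/
abbrev period : ℤ → ↥(upperHalf n) → Submodule ℂ 𝒱.V := 𝒱.L.develop 𝒱.F

/-- The monodromy `T_j`: parallel translation along `γ_j`. -/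
def T (j : Fin n) : Module.End ℚ 𝒱.VQ := 𝒱.L.transport (loop (cover (baseU n)) j)

/-- The monodromy is unipotent. -/
def HasUnipotentMonodromy : Prop := ∀ j, IsNilpotent (𝒱.T j - 1)

/-- `N_j = -log T_j`, over `ℚ`. -/
def NQ (j : Fin n) : Module.End ℚ 𝒱.VQ := -unipotentLog (𝒱.T j)

/-- `N_j = -log T_j`, acting on `V`. -/
def N (j : Fin n) : Module.End ℂ 𝒱.V := (𝒱.NQ j).baseChange ℂ

end VGPMHS

/-! ### Infinitesimal mixed Hodge modules and admissibility -/

/-- The data `(W, S, F, N_1, …, N_n)` form an infinitesimal mixed Hodge module. -/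
structure IsIMHM {n : ℕ} {H : Type u} [AddCommGroup H] [Module ℚ H]
    (W : ℤ → Submodule ℚ H) (S : ∀ k, LinearMap.BilinForm ℚ (Gr W k))
    (F : ℤ → Submodule ℂ (ℂ ⊗[ℚ] H)) (N : Fin n → Module.End ℚ H) : Prop where
  weight_filtration : IsWeightFiltration W
  hodge_filtration : IsHodgeFiltration F
  commute : ∀ i j, Commute (N i) (N j)
  nilpotent : ∀ j, IsNilpotent (N j)
  hodge_shift : ∀ j p, (F p).map ((N j).baseChange ℂ) ≤ F (p - 1)
  /-- `N_j` preserves `W` and acts on `Gr^W_k` by infinitesimal isometries of `S_k` -/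
  isometry : ∀ j, (N j).baseChange ℂ ∈ lieG W S
  /-- on `Gr^W_k`, the data define a nilpotent orbit of weight `k` polarized by `S_k` -/
  orbit : ∀ k, ∃ c : ℝ, ∀ z : Fin n → ℂ, (∀ j, c < (z j).im) →
    IsPolarizedHodge k
      (grF W (fun p => (F p).map (IsNilpotent.exp (∑ j, z j • (N j).baseChange ℂ))) k) (S k)
  /-- existence of the relative weight filtrations of `N_J = ∑_{j ∈ J} N_j` -/
  relative : ∀ J : Finset (Fin n), ∃ M, IsRelativeWeight (∑ j ∈ J, N j) W M
  relative_shift : ∀ (J : Finset (Fin n)), ∀ j ∈ J, ∀ k,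
    (relativeWeight (∑ j ∈ J, N j) W k).map (N j) ≤ relativeWeight (∑ j ∈ J, N j) W (k - 2)

namespace VGPMHS

variable {n : ℕ} (𝒱 : VGPMHS.{u} n)

/-- `e^{∑ z_j N_j}`. -/
def expN (z : Fin n → ℂ) : Module.End ℂ 𝒱.V := IsNilpotent.exp (∑ j, z j • 𝒱.N j)

/-- The variation `𝒱` (with unipotent monodromy) is admissible, with extended untwisted
period map `ψ`. The relation `F(z) = e^{∑ z_j N_j} ψ(e^{2πiz})` says that, over `Δ*ⁿ`, the
filtration `ψ(s)` is the Hodge filtration of `𝒱` at `s`, transported by the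
connection `∇ᶜ`. -/
structure IsAdmissible (ψ : ℤ → (Fin n → ℂ) → Submodule ℂ 𝒱.V) : Prop where
  unipotent : 𝒱.HasUnipotentMonodromy
  untwist : ∀ p (z : ↥(upperHalf n)), 𝒱.period p z = (ψ p (expMap z)).map (𝒱.expN z)
  /-- `ψ` is holomorphic on `Δⁿ` -/
  holomorphic : IsHolomorphicFiltration (O := polydisk n 1) (fun p s => ψ p s)
  /-- `ψ` takes its values in the compact dual of the classifying space -/
  filtration : ∀ s ∈ polydisk n 1, IsHodgeFiltration (fun p => ψ p s)
  hodge_numbers : ∀ s ∈ polydisk n 1, ∀ k p,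
    Module.finrank ℂ (grF 𝒱.WV (fun p => ψ p s) k p) =
      Module.finrank ℂ (grF 𝒱.WV (fun p => 𝒱.period p (baseU n)) k p)
  orthogonal : ∀ s ∈ polydisk n 1, ∀ k p,
    ∀ u ∈ grF 𝒱.WV (fun p => ψ p s) k p, ∀ v ∈ grF 𝒱.WV (fun p => ψ p s) k (k + 1 - p),
      ((𝒱.SV k).baseChange ℂ) u v = 0
  /-- the limiting data with `F_∞ = ψ(0)` form an infinitesimal mixed Hodge module -/
  imhm : IsIMHM 𝒱.WV 𝒱.SV (fun p => ψ p 0) 𝒱.NQ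

/-- The relative weight filtration `ʳW` of the monodromy cone, computed at the element
`N_1 + ⋯ + N_n` of the cone. -/
def relW : ℤ → Submodule ℚ 𝒱.VQ := relativeWeight (∑ j, 𝒱.NQ j) 𝒱.WV

/-- `U^p_∞ = ⨁_q I^{p,q}_{(F_∞, ʳW)}`, for a filtration `F_∞` of `V`. -/
def UInf (Finf : ℤ → Submodule ℂ 𝒱.V) : ℤ → Submodule ℂ 𝒱.V := hodgeU Finf 𝒱.relW

/-- `℘_a`: the elements of `Lie(G_ℂ)` mapping `U^p_∞` into `U^{p+a}_∞` for all `p`. -/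
def wp (Finf : ℤ → Submodule ℂ 𝒱.V) (a : ℤ) : Submodule ℂ (Module.End ℂ 𝒱.V) :=
  lieG 𝒱.WV 𝒱.SV ⊓ glGraded (𝒱.UInf Finf) a

/-- `q_∞ = ⨁_{a < 0} ℘_a`. -/
def qInf (Finf : ℤ → Submodule ℂ 𝒱.V) : Submodule ℂ (Module.End ℂ 𝒱.V) :=
  ⨆ (a : ℤ) (_ : a < 0), 𝒱.wp Finf a

/-- `Γ : Δⁿ_r → q_∞` is holomorphic, vanishes at `0` and satisfies `ψ(s) = e^{Γ(s)}.F_∞`, where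
`F_∞ = ψ(0)`. -/
structure IsPeriodLog (ψ : ℤ → (Fin n → ℂ) → Submodule ℂ 𝒱.V) (r : ℝ)
    (Γ : (Fin n → ℂ) → Module.End ℂ 𝒱.V) : Prop where
  holomorphic : IsHol (polydisk n r) Γ
  zero : Γ 0 = 0
  mem : ∀ s ∈ polydisk n r, Γ s ∈ 𝒱.qInf (fun p => ψ p 0)
  eq : ∀ s ∈ polydisk n r, ∀ p, ψ p s = (ψ p 0).map (IsNilpotent.exp (Γ s))

/-- The coefficient `Ω_j = N_j / (2πi s_j)` of `Ω = (1/2πi) ∑ ds_j/s_j ⊗ N_j`. -/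
def Omega (j : Fin n) (s : Fin n → ℂ) : Module.End ℂ 𝒱.V :=
  (2 * Real.pi * Complex.I * s j)⁻¹ • 𝒱.N j

/-- `X(z) = log(e^{∑ z_j N_j} e^{Γ(s)})`, `s = e^{2πiz}`. -/
def X (Γ : (Fin n → ℂ) → Module.End ℂ 𝒱.V) (z : Fin n → ℂ) : Module.End ℂ 𝒱.V :=
  unipotentLog (𝒱.expN z * IsNilpotent.exp (Γ (expMap z)))

end VGPMHS

end

/-!
With `s = e^{2πiz}`, the frame `g(z) = e^{∑ z_j N_j} e^{Γ(s)}` carries `F_∞` to the period map, and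
its logarithmic derivative `g⁻¹ ∂g` is the pull back of `e^{-ad Γ} Ω + e^{-Γ} ∂e^Γ`. Since `q_∞` is
a Lie algebra, this form takes its values in `q_∞`; by Griffiths horizontality these map
`F^p_∞ = ⨁_{r ≥ p} U^r_∞` to `F^{p-1}_∞`, and an element of `q_∞` doing so is of degree `-1`.

Commutators of elements of `q_∞` have degree at most `-2`. Modulo such degrees the form is
therefore `Ω + ∂Γ_{-1}`, hence equal to it, and `X` is `∑ z_j N_j + Γ_{-1}`. Thus
`g⁻¹ ∂g = ∂X_{-1}` is closed, so that the Maurer–Cartan equation of `g` becomes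
`(Ω + ∂Γ_{-1}) ∧ (Ω + ∂Γ_{-1}) = 0`.
-/

/-! ### Mixed Hodge structures and their Deligne bigrading -/

section GradedProjection

variable {ι R M : Type*} [DecidableEq ι] [Ring R] [AddCommGroup M] [Module R M]
  {A : ι → Submodule R M}

/-- The projection of an internal direct sum to its `i`-th summand, as an endomorphism. -/
noncomputable def gradedProj (hA : DirectSum.IsInternal A) (i : ι) : Module.End R M :=
  letI := hA.chooseDecomposition
  (A i).subtype ∘ₗ DirectSum.component R ι (fun i => A i) i ∘ₗ
    (DirectSum.decomposeLinearEquiv A).toLinearMap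

lemma gradedProj_mem (hA : DirectSum.IsInternal A) (i : ι) (x : M) : gradedProj hA i x ∈ A i :=
  Subtype.property _

lemma gradedProj_same (hA : DirectSum.IsInternal A) {i : ι} {x : M} (hx : x ∈ A i) :
    gradedProj hA i x = x :=
  let := hA.chooseDecomposition
  DirectSum.decompose_of_mem_same A hx

lemma gradedProj_ne (hA : DirectSum.IsInternal A) {i j : ι} (hij : i ≠ j) {x : M}
    (hx : x ∈ A i) : gradedProj hA j x = 0 :=
  let := hA.chooseDecomposition
  DirectSum.decompose_of_mem_ne A hx hij

lemma exists_eq_sum_gradedProj (hA : DirectSum.IsInternal A) (x : M) :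
    ∃ s : Finset ι, (∀ i ∈ s, gradedProj hA i x ≠ 0) ∧ ∑ i ∈ s, gradedProj hA i x = x := by
  classical
  let := hA.chooseDecomposition
  refine ⟨(DirectSum.decompose A x).support, fun i hi => ?_, DirectSum.sum_support_decompose A x⟩
  exact fun h => DFinsupp.mem_support_iff.1 hi (Subtype.ext h)

lemma mem_biSup_iff_gradedProj (hA : DirectSum.IsInternal A) (S : Set ι) (x : M) :
    x ∈ ⨆ i ∈ S, A i ↔ ∀ j ∉ S, gradedProj hA j x = 0 := by
  refine ⟨fun hx j hj => ?_, fun h => ?_⟩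
  · have hker : (⨆ i ∈ S, A i) ≤ LinearMap.ker (gradedProj hA j) :=
      iSup₂_le fun i hi y hy => gradedProj_ne hA (ne_of_mem_of_not_mem hi hj) hy
    exact hker hx
  · obtain ⟨s, hs, hsum⟩ := exists_eq_sum_gradedProj hA x
    rw [← hsum]
    refine Submodule.sum_mem _ fun i hi => ?_
    have hiS : i ∈ S := by_contra fun h' => hs i hi (h i h')
    exact Submodule.mem_iSup_of_mem i (Submodule.mem_iSup_of_mem hiS (gradedProj_mem hA i x))

lemma linearMap_ext_of_isInternal {N : Type*} [AddCommGroup N] [Module R N]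
    (hA : DirectSum.IsInternal A) {f g : M →ₗ[R] N} (h : ∀ i, ∀ x ∈ A i, f x = g x) : f = g := by
  have htop : (⊤ : Submodule R M) ≤ LinearMap.eqLocus f g := by
    rw [← hA.submodule_iSup_eq_top]
    exact iSup_le fun i x hx => h i x hx
  exact LinearMap.ext fun x => htop Submodule.mem_top

end GradedProjection

section Deligne

variable {H : Type u} [AddCommGroup H] [Module ℚ H]

lemma conjC_conjC (x : ℂ ⊗[ℚ] H) : conjC (conjC x) = x := by
  induction x using TensorProduct.induction_on with
  | zero => simp
  | tmul a h => simp [conjC]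
  | add x y hx hy => rw [map_add, map_add, hx, hy]

lemma baseChange_conjC {H' : Type*} [AddCommGroup H'] [Module ℚ H'] (f : H →ₗ[ℚ] H')
    (x : ℂ ⊗[ℚ] H) : f.baseChange ℂ (conjC x) = conjC (f.baseChange ℂ x) := by
  induction x using TensorProduct.induction_on with
  | zero => simp
  | tmul a h => simp [conjC]
  | add x y hx hy => rw [map_add, map_add, map_add, map_add, hx, hy]

lemma map_baseChange_le {R A M M' : Type*} [CommSemiring R] [Semiring A] [Algebra R A]
    [AddCommMonoid M] [Module R M] [AddCommMonoid M'] [Module R M'] {f : M →ₗ[R] M'}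
    {P : Submodule R M} {Q : Submodule R M'} (h : P.map f ≤ Q) :
    (P.baseChange A).map (f.baseChange A) ≤ Q.baseChange A := by
  rw [Submodule.baseChange_eq_span, Submodule.map_span, Submodule.span_le]
  rintro _ ⟨_, ⟨w, hw, rfl⟩, rfl⟩
  simpa using Submodule.tmul_mem_baseChange_of_mem (1 : A) (h ⟨w, hw, rfl⟩)

namespace IsDeligneBigrading

variable {F : ℤ → Submodule ℂ (ℂ ⊗[ℚ] H)} {W : ℤ → Submodule ℚ H}
  {I : ℤ → ℤ → Submodule ℂ (ℂ ⊗[ℚ] H)}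

/-- The sum of the `I^{p,q}` with `(p,q)` in a given set, in terms of which the Hodge filtration,
the weight filtration and complex conjugation are all described. -/
noncomputable def part (I : ℤ → ℤ → Submodule ℂ (ℂ ⊗[ℚ] H)) (S : Set (ℤ × ℤ)) :
    Submodule ℂ (ℂ ⊗[ℚ] H) :=
  ⨆ i ∈ S, I i.1 i.2

lemma le_part {S : Set (ℤ × ℤ)} {p q : ℤ} (h : (p, q) ∈ S) : I p q ≤ part I S :=
  le_iSup₂_of_le (f := fun (i : ℤ × ℤ) (_ : i ∈ S) => I i.1 i.2) (p, q) h le_rfl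

lemma part_le {S : Set (ℤ × ℤ)} {E : Submodule ℂ (ℂ ⊗[ℚ] H)}
    (h : ∀ p q, (p, q) ∈ S → I p q ≤ E) : part I S ≤ E :=
  iSup₂_le fun i hi => h i.1 i.2 hi

lemma part_mono {S T : Set (ℤ × ℤ)} (h : S ⊆ T) : part I S ≤ part I T :=
  part_le fun _ _ hi => le_part (h hi)

lemma mem_part (hI : IsDeligneBigrading F W I) {S : Set (ℤ × ℤ)} {x : ℂ ⊗[ℚ] H} :
    x ∈ part I S ↔ ∀ i ∉ S, gradedProj hI.internal i x = 0 :=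
  mem_biSup_iff_gradedProj hI.internal S x

lemma hodge_eq_part (hI : IsDeligneBigrading F W I) (p : ℤ) : F p = part I {i | p ≤ i.1} := by
  rw [hI.hodge]
  refine le_antisymm (iSup_le fun r => iSup_le fun hr => iSup_le fun s => le_part hr) ?_
  exact part_le fun r s hr => le_iSup_of_le r (le_iSup_of_le hr (le_iSup_of_le s le_rfl))

lemma weight_eq_part (hI : IsDeligneBigrading F W I) (k : ℤ) :
    (W k).baseChange ℂ = part I {i | i.1 + i.2 ≤ k} := by
  rw [hI.weight]
  refine le_antisymm (iSup_le fun r => iSup_le fun s => iSup_le fun hr => le_part hr) ?_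
  exact part_le fun r s hr => le_iSup_of_le r (le_iSup_of_le s (le_iSup_of_le hr le_rfl))

lemma conjC_mem (hI : IsDeligneBigrading F W I) {p q : ℤ} {x : ℂ ⊗[ℚ] H} (hx : x ∈ I p q) :
    conjC x ∈ part I {i | i = (q, p) ∨ i.1 < q ∧ i.2 < p} := by
  have hconj : conjC x ∈ conjSub (I p q) := by
    rwa [conjSub, Submodule.mem_comap, conjC_conjC]
  have hsup := Submodule.mem_sup_left
    (T := ⨆ (r : ℤ) (_ : r < q) (s : ℤ) (_ : s < p), I r s) hconj
  rw [← hI.conj q p] at hsup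
  refine (sup_le (le_part (Or.inl rfl)) ?_ : _ ≤ part I _) hsup
  exact iSup_le fun r => iSup_le fun hr => iSup_le fun s => iSup_le fun hs =>
    le_part (Or.inr ⟨hr, hs⟩)

lemma conjC_mem_part (hI : IsDeligneBigrading F W I) {p q : ℤ} {x : ℂ ⊗[ℚ] H}
    (hx : x ∈ part I {i | i.1 < p ∧ i.2 < q}) :
    conjC x ∈ part I {i | i.1 < q ∧ i.2 < p} := by
  have hle : part I {i | i.1 < p ∧ i.2 < q} ≤ (part I {i | i.1 < q ∧ i.2 < p}).comap conjC := by
    refine part_le fun r s ⟨hr, hs⟩ y hy => part_mono ?_ (hI.conjC_mem hy)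
    rintro _ (rfl | ⟨h1, h2⟩)
    · exact ⟨hs, hr⟩
    · exact ⟨h1.trans hs, h2.trans hr⟩
  exact hle hx

lemma eq_zero_of_conjC_mem (hI : IsDeligneBigrading F W I) {p q : ℤ} {x : ℂ ⊗[ℚ] H}
    (hx : x ∈ part I {i | p ≤ i.1 ∧ i.2 < q})
    (hc : conjC x ∈ part I {i | q ≤ i.1 ∨ i.2 < p}) : x = 0 := by
  obtain ⟨T, hT, hsum⟩ := exists_eq_sum_gradedProj hI.internal x
  rcases T.eq_empty_or_nonempty with rfl | hne
  · simpa using hsum.symm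
  exfalso
  -- a component `y` of `x` of maximal weight
  obtain ⟨⟨r, s⟩, hrs, hmax⟩ := T.exists_max_image (fun i => i.1 + i.2) hne
  set y := gradedProj hI.internal (r, s) x
  have hyI : y ∈ I r s := gradedProj_mem hI.internal (r, s) x
  have h_only : gradedProj hI.internal (s, r) (conjC x) =
      gradedProj hI.internal (s, r) (conjC y) := by
    rw [← hsum, map_sum, map_sum, Finset.sum_eq_single_of_mem _ hrs]
    rintro ⟨a, b⟩ hab hne
    refine hI.mem_part.1 (hI.conjC_mem (gradedProj_mem hI.internal (a, b) x)) _ ?_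
    rintro (h | ⟨hb, ha⟩)
    · exact hne (Prod.ext (Prod.mk.inj h).2.symm (Prod.mk.inj h).1.symm)
    · have := hmax _ hab
      dsimp only at this hb ha
      omega
  obtain ⟨hpr, hsq⟩ : p ≤ r ∧ s < q := by_contra fun h => hT _ hrs (hI.mem_part.1 hx _ h)
  have h_zero : gradedProj hI.internal (s, r) (conjC y) = 0 := by
    rw [← h_only]
    exact hI.mem_part.1 hc _ (by simp only [Set.mem_ofPred_eq]; omega)
  have h_lower : conjC y ∈ part I {i | i.1 < s ∧ i.2 < r} := by
    refine hI.mem_part.2 fun i hi => ?_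
    by_cases h : i = (s, r)
    · rw [h, h_zero]
    · exact hI.mem_part.1 (hI.conjC_mem hyI) i (not_or.2 ⟨h, hi⟩)
  have hy := hI.conjC_mem_part h_lower
  rw [conjC_conjC, hI.mem_part] at hy
  exact hT _ hrs <| (gradedProj_same (i := (r, s)) hI.internal hyI).symm.trans <|
    hy (r, s) fun h => lt_irrefl _ h.1

lemma mem_of_conjC_mem (hI : IsDeligneBigrading F W I) {p q : ℤ} {x : ℂ ⊗[ℚ] H}
    (hF : x ∈ F p) (hW : x ∈ (W (p + q)).baseChange ℂ)
    (hc : conjC x ∈ part I {i | q ≤ i.1 ∨ i.2 < p}) : x ∈ I p q := by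
  rw [hI.hodge_eq_part, hI.mem_part] at hF
  rw [hI.weight_eq_part, hI.mem_part] at hW
  set y := gradedProj hI.internal (p, q) x
  have hyI : y ∈ I p q := gradedProj_mem hI.internal (p, q) x
  have hmem : x - y ∈ part I {i | p ≤ i.1 ∧ i.2 < q} := by
    refine hI.mem_part.2 fun i hi => ?_
    rw [map_sub, sub_eq_zero]
    by_cases h : i = (p, q)
    · rw [h, gradedProj_same (i := (p, q)) hI.internal hyI]
    rw [gradedProj_ne hI.internal (Ne.symm h) hyI]
    by_cases hp : p ≤ i.1
    · refine hW i fun hpq => h (Prod.ext ?_ ?_) <;>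
        simp only [Set.mem_ofPred_eq] at hi hpq ⊢ <;> omega
    · exact hF i hp
  have hconj : conjC (x - y) ∈ part I {i | q ≤ i.1 ∨ i.2 < p} := by
    rw [map_sub]
    refine Submodule.sub_mem _ hc (part_mono ?_ (hI.conjC_mem hyI))
    rintro _ (rfl | ⟨-, h⟩)
    · exact Or.inl le_rfl
    · exact Or.inr h
  rw [sub_eq_zero.1 (hI.eq_zero_of_conjC_mem hmem hconj)]
  exact hyI

lemma map_mem (hI : IsDeligneBigrading F W I) {f : Module.End ℚ H}
    (hF : ∀ p, (F p).map (f.baseChange ℂ) ≤ F (p - 1))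
    (hW : ∀ k, (W k).map f ≤ W (k - 2)) {p q : ℤ} {x : ℂ ⊗[ℚ] H} (hx : x ∈ I p q) :
    f.baseChange ℂ x ∈ I (p - 1) (q - 1) := by
  have hFI : ∀ r s, ∀ y ∈ I r s, f.baseChange ℂ y ∈ F (r - 1) := fun r s y hy =>
    hF r ⟨y, by rw [hI.hodge_eq_part]; exact le_part (le_refl r) hy, rfl⟩
  have hWI : ∀ r s, ∀ y ∈ I r s, f.baseChange ℂ y ∈ (W (r + s - 2)).baseChange ℂ :=
    fun r s y hy => map_baseChange_le (hW _)
      ⟨y, by rw [hI.weight_eq_part]; exact le_part (le_refl (r + s)) hy, rfl⟩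
  have hconj : part I {i | i = (q, p) ∨ i.1 < q ∧ i.2 < p} ≤
      (part I {i | q - 1 ≤ i.1 ∨ i.2 < p - 1}).comap (f.baseChange ℂ) := by
    refine part_le fun r s hrs y hy => hI.mem_part.2 fun i hi => ?_
    by_cases hr : r - 1 ≤ i.1
    · have hWy := hWI r s y hy
      rw [hI.weight_eq_part] at hWy
      refine hI.mem_part.1 hWy i ?_
      simp only [Set.mem_ofPred_eq, Prod.mk.injEq] at hi hrs ⊢
      omega
    · have hFy := hFI r s y hy
      rw [hI.hodge_eq_part] at hFy
      exact hI.mem_part.1 hFy i hr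
  refine hI.mem_of_conjC_mem (hFI p q x hx) ?_ ?_
  · rw [show p - 1 + (q - 1) = p + q - 2 by ring]
    exact hWI p q x hx
  · rw [← baseChange_conjC]
    exact hconj (hI.conjC_mem hx)

end IsDeligneBigrading

end Deligne

/-! ### Gradings of `gl(V)` -/

lemma exp_eq_sum_complex {A : Type*} [Ring A] [Algebra ℂ A] [Module ℚ A] {a : A} {k : ℕ}
    (h : a ^ k = 0) :
    IsNilpotent.exp a = ∑ i ∈ Finset.range k, ((i.factorial : ℂ)⁻¹) • a ^ i := by
  rw [IsNilpotent.exp_eq_sum h]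
  exact Finset.sum_congr rfl fun i _ => inv_natCast_smul_eq ℚ ℂ i.factorial (a ^ i)

section GradedEnd

variable {V : Type u} [AddCommGroup V] [Module ℂ V] {U : ℤ → Submodule ℂ V}

lemma mul_mem_glGraded {a b : ℤ} {α β : Module.End ℂ V} (hα : α ∈ glGraded U a)
    (hβ : β ∈ glGraded U b) : α * β ∈ glGraded U (a + b) := fun p x hx => by
  rw [show p + (a + b) = p + b + a by ring]
  exact hα _ _ (hβ p x hx)

lemma one_mem_glGraded : (1 : Module.End ℂ V) ∈ glGraded U 0 := fun p x hx => by
  simpa using hx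

/-- The sum of the `gl(V)_a` with `a ≤ c`. -/
def glBelow (U : ℤ → Submodule ℂ V) (c : ℤ) : Submodule ℂ (Module.End ℂ V) :=
  ⨆ (a : ℤ) (_ : a ≤ c), glGraded U a

lemma glGraded_le_glBelow {a c : ℤ} (h : a ≤ c) : glGraded U a ≤ glBelow U c :=
  le_iSup₂_of_le (f := fun a (_ : a ≤ c) => glGraded U a) a h le_rfl

lemma glBelow_le {c : ℤ} {E : Submodule ℂ (Module.End ℂ V)} (h : ∀ a ≤ c, glGraded U a ≤ E) :
    glBelow U c ≤ E := iSup₂_le h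

lemma glBelow_mono {c d : ℤ} (h : c ≤ d) : glBelow U c ≤ glBelow U d :=
  glBelow_le fun _ ha => glGraded_le_glBelow (ha.trans h)

lemma mul_mem_glBelow {c d : ℤ} {α β : Module.End ℂ V} (hα : α ∈ glBelow U c)
    (hβ : β ∈ glBelow U d) : α * β ∈ glBelow U (c + d) := by
  have hright : glBelow U c ≤ (glBelow U (c + d)).comap (LinearMap.mulRight ℂ β) := by
    refine glBelow_le fun a ha α hα => ?_
    have hleft : glBelow U d ≤ (glBelow U (c + d)).comap (LinearMap.mulLeft ℂ α) :=
      glBelow_le fun b hb β hβ =>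
        glGraded_le_glBelow (add_le_add ha hb) (mul_mem_glGraded hα hβ)
    exact hleft hβ
  exact hright hα

lemma pow_mem_glBelow {α : Module.End ℂ V} (hα : α ∈ glBelow U (-1)) (k : ℕ) :
    α ^ k ∈ glBelow U (-k) := by
  induction k with
  | zero => simpa using glGraded_le_glBelow le_rfl one_mem_glGraded
  | succ k ih =>
    rw [pow_succ, Nat.cast_succ, neg_add]
    exact mul_mem_glBelow ih hα

lemma pow_add_two_mem_glBelow {α : Module.End ℂ V} (hα : α ∈ glBelow U (-1)) (k : ℕ) :
    α ^ (k + 2) ∈ glBelow U (-2) :=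
  glBelow_mono (by push_cast; omega) (pow_mem_glBelow hα (k + 2))

lemma commutator_mem_glBelow {x y : Module.End ℂ V} {c d : ℤ} (hx : x ∈ glBelow U c)
    (hy : y ∈ glBelow U d) : x * y - y * x ∈ glBelow U (c + d) :=
  Submodule.sub_mem _ (mul_mem_glBelow hx hy) (add_comm d c ▸ mul_mem_glBelow hy hx)

lemma exp_sub_one_sub_mem_glBelow [Module ℚ (Module.End ℂ V)] {α : Module.End ℂ V}
    (hα : α ∈ glBelow U (-1)) (hn : IsNilpotent α) :
    IsNilpotent.exp α - 1 - α ∈ glBelow U (-2) := by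
  obtain ⟨k, hk⟩ := hn
  have hsum : IsNilpotent.exp α - 1 - α =
      ∑ i ∈ Finset.range k, ((i + 2).factorial : ℂ)⁻¹ • α ^ (i + 2) := by
    rw [exp_eq_sum_complex (pow_eq_zero_of_le (Nat.le_add_right k 2) hk),
      Finset.sum_range_succ', Finset.sum_range_succ']
    simp
  rw [hsum]
  exact Submodule.sum_mem _ fun i _ => Submodule.smul_mem _ _ (pow_add_two_mem_glBelow hα i)

lemma unipotentLog_sub_mem_glBelow {g : Module.End ℂ V} [Module.Finite ℂ V]
    (hg : g - 1 ∈ glBelow U (-1)) : unipotentLog g - (g - 1) ∈ glBelow U (-2) := by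
  rcases h : Module.finrank ℂ V with _ | m
  · have : Subsingleton V := Module.finrank_zero_iff.1 h
    rw [Subsingleton.elim (unipotentLog g - (g - 1)) 0]
    exact Submodule.zero_mem _
  have hsum : unipotentLog g - (g - 1) = ∑ k ∈ Finset.range m,
      ((-1 : ℂ) ^ (k + 1) / (((k + 1 : ℕ) : ℂ) + 1)) • (g - 1) ^ (k + 2) := by
    rw [unipotentLog, h, Finset.sum_range_succ']
    simp
  rw [hsum]
  exact Submodule.sum_mem _ fun i _ => Submodule.smul_mem _ _ (pow_add_two_mem_glBelow hg i)

lemma unipotentLog_exp_mul_exp_sub_mem_glBelow [Module ℚ (Module.End ℂ V)] [Module.Finite ℂ V]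
    {α β : Module.End ℂ V} (hα : α ∈ glBelow U (-1)) (hβ : β ∈ glBelow U (-1))
    (hα' : IsNilpotent α) (hβ' : IsNilpotent β) :
    unipotentLog (IsNilpotent.exp α * IsNilpotent.exp β) - (α + β) ∈ glBelow U (-2) := by
  have hle : glBelow U (-2) ≤ glBelow U (-1) := glBelow_mono (by norm_num)
  have hexp : ∀ {γ : Module.End ℂ V}, γ ∈ glBelow U (-1) → IsNilpotent γ →
      IsNilpotent.exp γ - 1 ∈ glBelow U (-1) := fun hγ hγ' =>
    (Submodule.sub_mem_iff_left _ hγ).1 (hle (exp_sub_one_sub_mem_glBelow hγ hγ'))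
  have hsplit : ∀ x y : Module.End ℂ V, x * y - 1 - (α + β) =
      (x - 1 - α) + (y - 1 - β) + (x - 1) * (y - 1) := fun x y => by
    rw [mul_sub, sub_mul, mul_one, one_mul]
    abel
  have hmul := mul_mem_glBelow (hexp hα hα') (hexp hβ hβ')
  rw [show (-1 : ℤ) + -1 = -2 by norm_num] at hmul
  have hg : IsNilpotent.exp α * IsNilpotent.exp β - 1 - (α + β) ∈ glBelow U (-2) := by
    rw [hsplit]
    exact Submodule.add_mem _ (Submodule.add_mem _ (exp_sub_one_sub_mem_glBelow hα hα')
      (exp_sub_one_sub_mem_glBelow hβ hβ')) hmul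
  generalize IsNilpotent.exp α * IsNilpotent.exp β = g at hg ⊢
  have hg1 : g - 1 ∈ glBelow U (-1) :=
    (Submodule.sub_mem_iff_left _ (Submodule.add_mem _ hα hβ)).1 (hle hg)
  rw [← sub_add_sub_cancel (unipotentLog g) (g - 1)]
  exact Submodule.add_mem _ (unipotentLog_sub_mem_glBelow hg1) hg

lemma isComponent_of_sub_mem_glBelow {a c : ℤ} (hca : c < a) {α β : Module.End ℂ V}
    (hβ : β ∈ glGraded U a) (h : α - β ∈ glBelow U c) : IsComponent U a α β := by
  classical
  obtain ⟨f, hf, hsum⟩ := (Submodule.mem_iSup_iff_exists_finsupp _ _).1 h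
  have hfa : f a = 0 := by simpa [hca.not_ge] using hf a
  have hf' : ∀ b, f b ∈ glGraded U b := fun b =>
    (iSup_le fun _ => le_rfl : (⨆ _ : b ≤ c, glGraded U b) ≤ glGraded U b) (hf b)
  refine ⟨f + Finsupp.single a β, fun b => ?_, ?_, by simp [hfa]⟩
  · refine Submodule.add_mem _ (hf' b) ?_
    rcases eq_or_ne b a with rfl | hb
    · simpa using hβ
    · rw [Finsupp.single_eq_of_ne hb]
      exact Submodule.zero_mem _
  · rw [Finsupp.sum_add_index (by simp) (by simp), hsum]
    simp

/-- The projection of `gl(V)`, graded by `gl(V)_a`, to its component of degree `a`: it sends `α`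
to the endomorphism equal on `U^p` to the composition of `α` with the projection to
`U^{p+a}`. -/
noncomputable def glProj (hU : DirectSum.IsInternal U) (a : ℤ) :
    Module.End ℂ V →ₗ[ℂ] Module.End ℂ V :=
  letI := hU.chooseDecomposition
  { toFun α := (DirectSum.toModule ℂ ℤ V fun p =>
        gradedProj hU (p + a) ∘ₗ α ∘ₗ (U p).subtype) ∘ₗ
      (DirectSum.decomposeLinearEquiv U).toLinearMap
    map_add' α β := by
      rw [← LinearMap.add_comp]
      congr 1
      ext p x
      simp
    map_smul' c α := by
      rw [RingHom.id_apply, ← LinearMap.smul_comp]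
      congr 1
      ext p x
      simp }

lemma glProj_apply_of_mem (hU : DirectSum.IsInternal U) (a : ℤ) (α : Module.End ℂ V) {p : ℤ}
    {x : V} (hx : x ∈ U p) : glProj hU a α x = gradedProj hU (p + a) (α x) := by
  let := hU.chooseDecomposition
  change DirectSum.toModule ℂ ℤ V _ (DirectSum.decompose U x) = _
  rw [DirectSum.decompose_of_mem U hx, ← DirectSum.lof_eq_of ℂ, DirectSum.toModule_lof]
  rfl

lemma glProj_mem (hU : DirectSum.IsInternal U) (a : ℤ) (α : Module.End ℂ V) :
    glProj hU a α ∈ glGraded U a := fun p x hx => by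
  rw [glProj_apply_of_mem hU a α hx]
  exact gradedProj_mem hU _ _

lemma glProj_same (hU : DirectSum.IsInternal U) {a : ℤ} {α : Module.End ℂ V}
    (hα : α ∈ glGraded U a) : glProj hU a α = α :=
  linearMap_ext_of_isInternal hU fun p x hx => by
    rw [glProj_apply_of_mem hU a α hx, gradedProj_same hU (hα p x hx)]

lemma glProj_ne (hU : DirectSum.IsInternal U) {a b : ℤ} (hba : b ≠ a) {α : Module.End ℂ V}
    (hα : α ∈ glGraded U b) : glProj hU a α = 0 :=
  linearMap_ext_of_isInternal hU fun p x hx => by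
    rw [glProj_apply_of_mem hU a α hx, gradedProj_ne hU (by omega) (hα p x hx),
      LinearMap.zero_apply]

lemma glProj_eq_of_sub_mem_glBelow (hU : DirectSum.IsInternal U) {a c : ℤ} (hca : c < a)
    {α β : Module.End ℂ V} (h : α - β ∈ glBelow U c) : glProj hU a α = glProj hU a β := by
  have hker : glBelow U c ≤ LinearMap.ker (glProj hU a) :=
    glBelow_le fun b hb γ hγ => glProj_ne hU (by omega) hγ
  rw [← sub_eq_zero, ← map_sub]
  exact hker h

end GradedEnd

section LieGraded

variable {V : Type u} [AddCommGroup V] [Module ℂ V] {U : ℤ → Submodule ℂ V}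
  {g : Submodule ℂ (Module.End ℂ V)}

/-- The sum of the graded parts `g ∩ gl(V)_a`, `a < 0`, of a subspace `g` of `gl(V)`. For
`g = Lie(G_ℂ)` this is `q_∞`. -/
def negPart (g : Submodule ℂ (Module.End ℂ V)) (U : ℤ → Submodule ℂ V) :
    Submodule ℂ (Module.End ℂ V) :=
  ⨆ (a : ℤ) (_ : a < 0), g ⊓ glGraded U a

lemma le_negPart {a : ℤ} (ha : a < 0) : g ⊓ glGraded U a ≤ negPart g U :=
  le_iSup₂_of_le (f := fun a (_ : a < 0) => g ⊓ glGraded U a) a ha le_rfl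

lemma negPart_le {E : Submodule ℂ (Module.End ℂ V)} (h : ∀ a < 0, g ⊓ glGraded U a ≤ E) :
    negPart g U ≤ E := iSup₂_le h

lemma negPart_le_glBelow : negPart g U ≤ glBelow U (-1) :=
  negPart_le fun _ ha => inf_le_right.trans (glGraded_le_glBelow (by omega))

lemma negPart_le_self : negPart g U ≤ g := negPart_le fun _ _ => inf_le_left

lemma commutator_mem_negPart (hg : ∀ α ∈ g, ∀ β ∈ g, α * β - β * α ∈ g)
    {α β : Module.End ℂ V} (hα : α ∈ negPart g U) (hβ : β ∈ negPart g U) :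
    α * β - β * α ∈ negPart g U := by
  have hright : negPart g U ≤
      (negPart g U).comap (LinearMap.mulRight ℂ β - LinearMap.mulLeft ℂ β) := by
    refine negPart_le fun a ha α hα => ?_
    have hleft : negPart g U ≤
        (negPart g U).comap (LinearMap.mulLeft ℂ α - LinearMap.mulRight ℂ α) := by
      refine negPart_le fun b hb β hβ => le_negPart (add_neg ha hb) ⟨hg _ hα.1 _ hβ.1, ?_⟩
      exact Submodule.sub_mem _ (mul_mem_glGraded hα.2 hβ.2)
        (add_comm b a ▸ mul_mem_glGraded hβ.2 hα.2)
    exact hleft hβ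
  exact hright hα

lemma glProj_mem_of_mem_negPart (hU : DirectSum.IsInternal U) {α : Module.End ℂ V}
    (hα : α ∈ negPart g U) :
    glProj hU (-1) α ∈ g ∧ α - glProj hU (-1) α ∈ glBelow U (-2) := by
  have hle : negPart g U ≤ g.comap (glProj hU (-1)) ⊓
      (glBelow U (-2)).comap (LinearMap.id - glProj hU (-1)) := by
    refine negPart_le fun a ha α hα => ?_
    rcases eq_or_ne a (-1) with rfl | h
    · simpa [glProj_same hU hα.2] using hα.1
    · simpa [glProj_ne hU h hα.2] using glGraded_le_glBelow (c := -2) (by omega) hα.2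
  exact hle hα

lemma mem_glGraded_neg_one_of_shift (hU : DirectSum.IsInternal U) {α : Module.End ℂ V}
    (hα : α ∈ glBelow U (-1))
    (hF : ∀ p, ∀ x ∈ ⨆ (r : ℤ) (_ : p ≤ r), U r, α x ∈ ⨆ (r : ℤ) (_ : p - 1 ≤ r), U r) :
    α ∈ glGraded U (-1) := by
  intro p x hx
  have hlow : α x ∈ ⨆ r ∈ {r | r ≤ p - 1}, U r := by
    have hle : glBelow U (-1) ≤ (⨆ r ∈ {r | r ≤ p - 1}, U r).comap (LinearMap.applyₗ x) :=
      glBelow_le fun a ha β hβ => Submodule.mem_iSup_of_mem (p + a) <|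
        Submodule.mem_iSup_of_mem (show p + a ≤ p - 1 by omega) (hβ p x hx)
    exact hle hα
  have hhigh : α x ∈ ⨆ r ∈ {r | p - 1 ≤ r}, U r :=
    hF p x (Submodule.mem_iSup_of_mem p (Submodule.mem_iSup_of_mem le_rfl hx))
  rw [mem_biSup_iff_gradedProj hU] at hlow hhigh
  suffices h : α x ∈ ⨆ r ∈ ({p + -1} : Set ℤ), U r by simpa using h
  refine (mem_biSup_iff_gradedProj hU _ _).2 fun r hr => ?_
  rcases lt_or_gt_of_ne hr with h | h
  · exact hhigh r (by simp only [Set.mem_ofPred_eq]; omega)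
  · exact hlow r (by simp only [Set.mem_ofPred_eq]; omega)

end LieGraded

section Adjoint

variable {V : Type u} [AddCommGroup V] [Module ℂ V]

lemma neg_adEnd_eq (x : Module.End ℂ V) :
    -adEnd x = LinearMap.mulLeft ℂ (-x) + LinearMap.mulRight ℂ x := by
  ext y : 1
  simp only [adEnd, LinearMap.neg_apply, LinearMap.sub_apply, LinearMap.add_apply,
    LinearMap.mulLeft_apply, LinearMap.mulRight_apply]
  noncomm_ring

lemma isNilpotent_neg_adEnd {x : Module.End ℂ V} (hx : IsNilpotent x) :
    IsNilpotent (-adEnd x) := by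
  rw [neg_adEnd_eq]
  exact (LinearMap.commute_mulLeft_right _ _).isNilpotent_add
    ((LinearMap.isNilpotent_mulLeft_iff _ _).2 hx.neg)
    ((LinearMap.isNilpotent_mulRight_iff _ _).2 hx)

lemma exp_mulLeft [Module ℚ (Module.End ℂ V)] [Module ℚ (Module.End ℂ (Module.End ℂ V))]
    {x : Module.End ℂ V} (hx : IsNilpotent x) :
    IsNilpotent.exp (LinearMap.mulLeft ℂ x) = LinearMap.mulLeft ℂ (IsNilpotent.exp x) :=
  (hx.map_exp (Algebra.lmul ℂ (Module.End ℂ V))).symm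

lemma exp_mulRight [Module ℚ (Module.End ℂ V)] [Module ℚ (Module.End ℂ (Module.End ℂ V))]
    {x : Module.End ℂ V} (hx : IsNilpotent x) :
    IsNilpotent.exp (LinearMap.mulRight ℂ x) = LinearMap.mulRight ℂ (IsNilpotent.exp x) := by
  obtain ⟨k, hk⟩ := hx
  have hk' : LinearMap.mulRight ℂ x ^ k = 0 := by
    rw [LinearMap.pow_mulRight, hk, LinearMap.mulRight_zero_eq_zero]
  rw [exp_eq_sum_complex hk', exp_eq_sum_complex hk]
  ext y : 1
  simp [LinearMap.sum_apply, LinearMap.pow_mulRight, Finset.mul_sum]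

lemma exp_neg_adEnd_apply [Module ℚ (Module.End ℂ V)] [Module ℚ (Module.End ℂ (Module.End ℂ V))]
    {x : Module.End ℂ V} (hx : IsNilpotent x) (y : Module.End ℂ V) :
    IsNilpotent.exp (-adEnd x) y = IsNilpotent.exp (-x) * y * IsNilpotent.exp x := by
  rw [neg_adEnd_eq, IsNilpotent.exp_add_of_commute (LinearMap.commute_mulLeft_right _ _)
    ((LinearMap.isNilpotent_mulLeft_iff _ _).2 hx.neg)
    ((LinearMap.isNilpotent_mulRight_iff _ _).2 hx), exp_mulLeft hx.neg, exp_mulRight hx]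
  simp [mul_assoc]

lemma exp_neg_adEnd_sub_mem [Module ℚ (Module.End ℂ (Module.End ℂ V))]
    {M : Submodule ℂ (Module.End ℂ V)} {x y : Module.End ℂ V} (hx : IsNilpotent x)
    (hM : ∀ z ∈ M, x * z - z * x ∈ M) (hy : x * y - y * x ∈ M) :
    IsNilpotent.exp (-adEnd x) y - y ∈ M := by
  obtain ⟨k, hk⟩ := isNilpotent_neg_adEnd hx
  have had : ∀ i, ((-adEnd x) ^ (i + 1)) y ∈ M := fun i => by
    induction i with
    | zero => simpa [adEnd] using M.neg_mem hy
    | succ i ih =>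
      rw [pow_succ', Module.End.mul_apply]
      exact M.neg_mem (hM _ ih)
  have hsum : IsNilpotent.exp (-adEnd x) y - y =
      ∑ i ∈ Finset.range k, ((i + 1).factorial : ℂ)⁻¹ • ((-adEnd x) ^ (i + 1)) y := by
    rw [exp_eq_sum_complex (pow_eq_zero_of_le (Nat.le_succ k) hk), Finset.sum_range_succ']
    simp
  rw [hsum]
  exact M.sum_mem fun i _ => M.smul_mem _ (had i)

end Adjoint

section LieG

variable {H : Type u} [AddCommGroup H] [Module ℚ H]

lemma commutator_mem_lieG {W : ℤ → Submodule ℚ H} {S : ∀ k, LinearMap.BilinForm ℚ (Gr W k)}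
    {α β : Module.End ℂ (ℂ ⊗[ℚ] H)} (hα : α ∈ lieG W S) (hβ : β ∈ lieG W S) :
    α * β - β * α ∈ lieG W S := by
  intro k
  obtain ⟨a, b, h1, h2, h3⟩ := hα k
  obtain ⟨a', b', h1', h2', h3'⟩ := hβ k
  refine ⟨a * a' - a' * a, b * b' - b' * b, fun x => ?_, fun x => ?_, fun u v => ?_⟩
  · simp only [LinearMap.sub_apply, Module.End.mul_apply, map_sub, h1, h1']
  · simp only [LinearMap.sub_apply, Module.End.mul_apply, map_sub, h2, h2']
  · have e1 := h3 (b' u) v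
    have e2 := h3' (b u) v
    have e3 := h3 u (b' v)
    have e4 := h3' u (b v)
    simp only [LinearMap.sub_apply, Module.End.mul_apply, map_sub]
    linear_combination e1 - e2 + e3 - e4

end LieG

namespace IsDeligneBigrading

variable {H : Type u} [AddCommGroup H] [Module ℚ H] {F : ℤ → Submodule ℂ (ℂ ⊗[ℚ] H)}
  {W : ℤ → Submodule ℚ H} {I : ℤ → ℤ → Submodule ℂ (ℂ ⊗[ℚ] H)}

lemma isInternal_iSup (hI : IsDeligneBigrading F W I) :
    DirectSum.IsInternal fun p => ⨆ q, I p q := by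
  rw [DirectSum.isInternal_submodule_iff_iSupIndep_and_iSup_eq_top]
  refine ⟨fun p => Submodule.disjoint_def.2 fun x hp hne => ?_, ?_⟩
  · have hp' : x ∈ part I {i | i.1 = p} :=
      (iSup_le fun q => le_part rfl : (⨆ q, I p q) ≤ _) hp
    have hne' : x ∈ part I {i | i.1 ≠ p} :=
      (iSup₂_le fun r hr => iSup_le fun q => le_part hr :
        (⨆ (r : ℤ) (_ : r ≠ p), ⨆ q, I r q) ≤ _) hne
    rw [hI.mem_part] at hp' hne'
    obtain ⟨s, -, hs⟩ := exists_eq_sum_gradedProj hI.internal x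
    refine hs.symm.trans (Finset.sum_eq_zero fun i _ => ?_)
    by_cases hi : i.1 = p
    · exact hne' i (by simpa using hi)
    · exact hp' i hi
  · rw [← top_le_iff, ← hI.internal.submodule_iSup_eq_top]
    exact iSup_le fun i => le_iSup_of_le i.1 (le_iSup (fun q => I i.1 q) i.2)

lemma mem_glGraded (hI : IsDeligneBigrading F W I) {f : Module.End ℚ H}
    (hF : ∀ p, (F p).map (f.baseChange ℂ) ≤ F (p - 1)) (hW : ∀ k, (W k).map f ≤ W (k - 2)) :
    f.baseChange ℂ ∈ glGraded (fun p => ⨆ q, I p q) (-1) := by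
  intro p x hx
  have hle : (⨆ q, I p q) ≤ (⨆ q, I (p + -1) q).comap (f.baseChange ℂ) :=
    iSup_le fun q y hy => Submodule.mem_iSup_of_mem (q - 1) (hI.map_mem hF hW hy)
  exact hle hx

end IsDeligneBigrading

/-! ### Second derivatives of holomorphic functions of several variables -/

section SeveralVariables

open MeasureTheory Metric

variable {E : Type*} [NormedAddCommGroup E] [NormedSpace ℂ E] {f : E → ℂ} {O : Set E}

lemma fderiv_apply_eq_circleIntegral (hO : IsOpen O) (hf : DifferentiableOn ℂ f O) {s v : E}
    {δ : ℝ} (hδ : 0 < δ) (hs : ∀ t ∈ closedBall (0 : ℂ) δ, s + t • v ∈ O) :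
    fderiv ℂ f s v =
      (2 * Real.pi * Complex.I)⁻¹ * ∮ t in C(0, δ), ((t - 0) ^ 2)⁻¹ * f (s + t • v) := by
  have hline : ∀ t : ℂ, HasDerivAt (fun t : ℂ => s + t • v) v t := fun t => by
    simpa using ((hasDerivAt_id t).smul_const v).const_add s
  have hderiv : ∀ t : ℂ, s + t • v ∈ O →
      HasDerivAt (fun t : ℂ => f (s + t • v)) (fderiv ℂ f (s + t • v) v) t := fun t ht =>
    (hf.differentiableAt (hO.mem_nhds ht)).hasFDerivAt.comp_hasDerivAt t (hline t)
  have hcauchy := Complex.two_pi_I_inv_smul_circleIntegral_sub_sq_inv_smul_of_differentiable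
    (hO.preimage (continuous_iff_continuousAt.2 fun t => (hline t).continuousAt)) hs
    (fun t ht => (hderiv t ht).differentiableAt.differentiableWithinAt) (mem_ball_self hδ)
  rw [(hderiv 0 (hs 0 (mem_closedBall_self hδ.le))).deriv, zero_smul, add_zero] at hcauchy
  exact hcauchy.symm

variable [FiniteDimensional ℂ E]

lemma exists_norm_fderiv_le_of_isCompact (hO : IsOpen O) (hf : DifferentiableOn ℂ f O) {K : Set E}
    (hK : IsCompact K) (hKO : K ⊆ O) :
    ∃ r > 0, ∃ C, thickening r K ⊆ O ∧ ∀ y ∈ thickening r K, ‖fderiv ℂ f y‖ ≤ C := by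
  have := FiniteDimensional.proper ℂ E
  obtain ⟨r, hr, hrO⟩ := hK.exists_cthickening_subset_open hO hKO
  obtain ⟨M, hM⟩ := hK.cthickening.exists_bound_of_continuousOn (hf.continuousOn.mono hrO)
  have hsub : thickening (r / 2) K ⊆ cthickening r K :=
    (thickening_subset_cthickening _ _).trans (cthickening_mono (by linarith) K)
  refine ⟨r / 2, by positivity, 2 * M / (r / 2), hsub.trans hrO, fun y hy => ?_⟩
  have hball : ball y (r / 2) ⊆ cthickening r K := fun z hz => by
    obtain ⟨x, hx, hyx⟩ := mem_thickening_iff.1 hy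
    refine thickening_subset_cthickening _ _ (mem_thickening_iff.2 ⟨x, hx, ?_⟩)
    linarith [dist_triangle z y x, mem_ball.1 hz]
  refine Complex.norm_fderiv_le_div_of_mapsTo_ball (hf.mono (hball.trans hrO)) (fun z hz => ?_)
    (by positivity)
  rw [mem_closedBall, dist_eq_norm]
  linarith [norm_sub_le (f z) (f y), hM z (hball hz), hM y (hsub hy)]

lemma differentiableAt_circleIntegral_comp (hO : IsOpen O) (hf : DifferentiableOn ℂ f O)
    {k : ℂ → ℂ} {δ : ℝ} (hk : ContinuousOn k (sphere 0 δ)) (hδ : 0 ≤ δ) {s v : E}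
    (hs : ∀ t ∈ sphere (0 : ℂ) δ, s + t • v ∈ O) :
    DifferentiableAt ℂ (fun s => ∮ t in C(0, δ), k t * f (s + t • v)) s := by
  have hKc : IsCompact ((fun t : ℂ => s + t • v) '' sphere 0 δ) :=
    (isCompact_sphere 0 δ).image (by fun_prop)
  obtain ⟨r, hr, C, hrO, hC⟩ := exists_norm_fderiv_le_of_isCompact hO hf hKc
    (Set.image_subset_iff.2 hs)
  have hmem : ∀ x ∈ ball s r, ∀ θ, x + circleMap 0 δ θ • v ∈
      thickening r ((fun t : ℂ => s + t • v) '' sphere 0 δ) := fun x hx θ =>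
    mem_thickening_iff.2 ⟨_, ⟨_, circleMap_mem_sphere 0 hδ θ, rfl⟩, by simpa using hx⟩
  set c : ℝ → ℂ := fun θ => deriv (circleMap 0 δ) θ * k (circleMap 0 δ θ)
  have hc : Continuous c := by
    simp only [c, deriv_circleMap]
    exact (by fun_prop : Continuous fun θ => circleMap 0 δ θ * Complex.I).mul
      (hk.comp_continuous (continuous_circleMap 0 δ) (circleMap_mem_sphere 0 hδ))
  have hcont : ∀ x ∈ ball s r, Continuous fun θ => c θ * f (x + circleMap 0 δ θ • v) :=
    fun x hx => hc.mul (hf.continuousOn.comp_continuous (by fun_prop) fun θ => hrO (hmem x hx θ))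
  have hderiv : ∀ θ, ∀ x ∈ ball s r, HasFDerivAt (fun x => c θ * f (x + circleMap 0 δ θ • v))
      (c θ • fderiv ℂ f (x + circleMap 0 δ θ • v)) x := fun θ x hx => by
    have hfx := (hf.differentiableAt (hO.mem_nhds (hrO (hmem x hx θ)))).hasFDerivAt
    simpa using (hfx.comp x ((hasFDerivAt_id x).add_const _)).const_mul (c θ)
  have hmeas : StronglyMeasurable fun θ => c θ • fderiv ℂ f (s + circleMap 0 δ θ • v) := by
    borelize E
    exact hc.stronglyMeasurable.smul ((measurable_fderiv ℂ f).stronglyMeasurable.comp_measurable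
      (by fun_prop : Continuous fun θ => s + circleMap 0 δ θ • v).measurable)
  simp only [circleIntegral, smul_eq_mul, ← mul_assoc]
  refine (intervalIntegral.hasFDerivAt_integral_of_dominated_of_fderiv_le
    (F' := fun x θ => c θ • fderiv ℂ f (x + circleMap 0 δ θ • v))
    (bound := fun θ => ‖c θ‖ * C) (ball_mem_nhds s hr) ?_
    ((hcont s (mem_ball_self hr)).intervalIntegrable _ _) hmeas.aestronglyMeasurable ?_
    ((hc.norm.mul_const C).intervalIntegrable _ _)
    (.of_forall fun θ _ => hderiv θ)).differentiableAt
  · filter_upwards [ball_mem_nhds s hr] with x hx using (hcont x hx).aestronglyMeasurable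
  · refine .of_forall fun θ _ x hx => ?_
    rw [norm_smul]
    exact mul_le_mul_of_nonneg_left (hC _ (hmem x hx θ)) (norm_nonneg _)

lemma differentiableOn_fderiv_apply (hO : IsOpen O) (hf : DifferentiableOn ℂ f O) (v : E) :
    DifferentiableOn ℂ (fun s => fderiv ℂ f s v) O := by
  intro s hs
  obtain ⟨U, hU, B, hB, hUB⟩ : ∃ U ∈ nhds s, ∃ B ∈ nhds (0 : ℂ),
      ∀ x ∈ U, ∀ t ∈ B, x + t • v ∈ O := by
    have hcont : ContinuousAt (fun p : E × ℂ => p.1 + p.2 • v) (s, 0) := by fun_prop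
    obtain ⟨U, hU, B, hB, hsub⟩ := mem_nhds_prod_iff.1
      (hcont.preimage_mem_nhds (hO.mem_nhds (by simpa using hs)))
    exact ⟨U, hU, B, hB, fun x hx t ht => hsub (Set.mk_mem_prod hx ht)⟩
  obtain ⟨δ, hδ, hδB⟩ := nhds_basis_closedBall.mem_iff.1 hB
  have hk : ContinuousOn (fun t : ℂ => ((t - 0) ^ 2)⁻¹) (sphere 0 δ) :=
    ContinuousOn.inv₀ (by fun_prop) fun t ht => by
      simpa using ne_zero_of_mem_sphere hδ.ne' ⟨t, ht⟩
  have hdiff := differentiableAt_circleIntegral_comp hO hf hk hδ.le (s := s) (v := v)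
    fun t ht => hUB s (mem_of_mem_nhds hU) t (hδB (sphere_subset_closedBall ht))
  refine ((hdiff.const_mul (2 * Real.pi * Complex.I)⁻¹).congr_of_eventuallyEq
    ?_).differentiableWithinAt
  filter_upwards [hU] with x hx using
    fderiv_apply_eq_circleIntegral hO hf hδ fun t ht => hUB x hx t (hδB ht)

lemma contDiffOn_of_differentiableOn_complex (hO : IsOpen O) (hf : DifferentiableOn ℂ f O) (m : ℕ) :
    ContDiffOn ℂ m f O := by
  induction m generalizing f with
  | zero => exact contDiffOn_zero.2 hf.continuousOn
  | succ m ih =>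
    rw [Nat.cast_succ, contDiffOn_succ_iff_fderiv_of_isOpen hO, contDiffOn_clm_apply]
    exact ⟨hf, by simp, fun v => ih (differentiableOn_fderiv_apply hO hf v)⟩

lemma fderiv_fderiv_apply_comm (hO : IsOpen O) (hf : DifferentiableOn ℂ f O) {x : E} (hx : x ∈ O)
    (v w : E) :
    fderiv ℂ (fun s => fderiv ℂ f s v) x w = fderiv ℂ (fun s => fderiv ℂ f s w) x v := by
  have hf2 : ContDiffAt ℂ 2 f x :=
    (contDiffOn_of_differentiableOn_complex hO hf 2).contDiffAt (hO.mem_nhds hx)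
  have hf' : DifferentiableAt ℂ (fderiv ℂ f) x :=
    (hf2.fderiv_right (m := 1) (by norm_num)).differentiableAt (by norm_num)
  simpa [fderiv_clm_apply hf' (differentiableAt_const _)] using
    hf2.isSymmSndFDerivAt (by simp) w v

end SeveralVariables

/-! ### Calculus of maps into finite dimensional vector spaces -/

section WeakCalculus

variable {V W X : Type*} [AddCommGroup V] [Module ℂ V] [AddCommGroup W] [Module ℂ W]
  [AddCommGroup X] [Module ℂ X]

/-- `w` is the derivative at `t` of the curve `φ` in a finite dimensional vector space without a
chosen norm: every linear form `l ∘ φ` has derivative `l w`. Since `HasPartial j f s w` says that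
`w` is the derivative at `s j` of `t ↦ f (Function.update s j t)`, rules for `HasPartial` are
instances of rules for curves. -/
def HasWeakDerivAt (φ : ℂ → V) (w : V) (t : ℂ) : Prop :=
  ∀ l : Module.Dual ℂ V, HasDerivAt (fun t => l (φ t)) (l w) t

lemma eq_sum_dualBasis_mul_of_bilin {ι κ : Type*} [Fintype ι] [Fintype κ]
    (b : Module.Basis ι ℂ V) (c : Module.Basis κ ℂ W) (B : V →ₗ[ℂ] W →ₗ[ℂ] ℂ) (x : V) (y : W) :
    B x y = ∑ i, ∑ k, B (b i) (c k) * (b.coord i x * c.coord k y) := by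
  conv_lhs => rw [← b.sum_repr x, ← c.sum_repr y]
  simp only [map_sum, map_smul, LinearMap.sum_apply, LinearMap.smul_apply, smul_eq_mul,
    Finset.mul_sum, Module.Basis.coord_apply]
  rw [Finset.sum_comm]
  exact Finset.sum_congr rfl fun i _ => Finset.sum_congr rfl fun k _ => by ring

namespace HasWeakDerivAt

variable {φ : ℂ → V} {χ : ℂ → W} {v : V} {w : W} {t : ℂ}

lemma unique {v' : V} (h : HasWeakDerivAt φ v t) (h' : HasWeakDerivAt φ v' t) : v = v' :=
  sub_eq_zero.1 <| (Module.forall_dual_apply_eq_zero_iff ℂ _).1 fun l => by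
    rw [map_sub, (h l).unique (h' l), sub_self]

lemma congr_of_eventuallyEq {ψ : ℂ → V} (h : HasWeakDerivAt φ v t) (hψ : ψ =ᶠ[nhds t] φ) :
    HasWeakDerivAt ψ v t := fun l => (h l).congr_of_eventuallyEq (hψ.fun_comp l)

lemma const (c : V) : HasWeakDerivAt (fun _ => c) 0 t := fun l => by
  simpa using hasDerivAt_const t (l c)

lemma smul_const {c : ℂ → ℂ} {c' : ℂ} (h : HasDerivAt c c' t) (x : V) :
    HasWeakDerivAt (fun t => c t • x) (c' • x) t := fun l => by
  simpa using h.mul_const (l x)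

lemma linear (h : HasWeakDerivAt φ v t) (L : V →ₗ[ℂ] W) :
    HasWeakDerivAt (fun t => L (φ t)) (L v) t := fun l => h (l ∘ₗ L)

lemma add {ψ : ℂ → V} {v' : V} (h : HasWeakDerivAt φ v t) (h' : HasWeakDerivAt ψ v' t) :
    HasWeakDerivAt (fun t => φ t + ψ t) (v + v') t := fun l => by
  simp only [map_add]
  exact (h l).add (h' l)

lemma sub {ψ : ℂ → V} {v' : V} (h : HasWeakDerivAt φ v t) (h' : HasWeakDerivAt ψ v' t) :
    HasWeakDerivAt (fun t => φ t - ψ t) (v - v') t := fun l => by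
  simp only [map_sub]
  exact (h l).sub (h' l)

lemma sum {ι : Type*} {S : Finset ι} {φ : ι → ℂ → V} {v : ι → V}
    (h : ∀ i ∈ S, HasWeakDerivAt (φ i) (v i) t) :
    HasWeakDerivAt (fun t => ∑ i ∈ S, φ i t) (∑ i ∈ S, v i) t := fun l => by
  simpa only [map_sum] using HasDerivAt.fun_sum fun i hi => h i hi l

lemma bilin [Module.Finite ℂ V] [Module.Finite ℂ W] (B : V →ₗ[ℂ] W →ₗ[ℂ] X)
    (hφ : HasWeakDerivAt φ v t) (hχ : HasWeakDerivAt χ w t) :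
    HasWeakDerivAt (fun t => B (φ t) (χ t)) (B v (χ t) + B (φ t) w) t := by
  intro l
  have hcoord := eq_sum_dualBasis_mul_of_bilin (Module.finBasis ℂ V) (Module.finBasis ℂ W)
    (B.compr₂ l)
  simp only [LinearMap.compr₂_apply] at hcoord
  rw [map_add, funext fun t => hcoord (φ t) (χ t), hcoord, hcoord]
  simp only [← Finset.sum_add_distrib, ← mul_add]
  exact HasDerivAt.fun_sum fun i _ => HasDerivAt.fun_sum fun k _ =>
    ((hφ _).mul (hχ _)).const_mul _

lemma mul {A : Type*} [Ring A] [Algebra ℂ A] [Module.Finite ℂ A] {φ χ : ℂ → A} {v w : A}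
    (hφ : HasWeakDerivAt φ v t) (hχ : HasWeakDerivAt χ w t) :
    HasWeakDerivAt (fun t => φ t * χ t) (v * χ t + φ t * w) t :=
  bilin (LinearMap.mul ℂ A) hφ hχ

lemma mem_of_eventually_mem {M : Submodule ℂ V} (h : HasWeakDerivAt φ v t)
    (hφ : ∀ᶠ t in nhds t, φ t ∈ M) : v ∈ M := by
  by_contra hv
  obtain ⟨l, hl, hlM⟩ := Submodule.exists_le_ker_of_notMem hv
  refine hl ((h l).unique ((hasDerivAt_const t (0 : ℂ)).congr_of_eventuallyEq ?_))
  exact hφ.mono fun t ht => hlM ht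

lemma sub_mem_of_forall_mem {M : Submodule ℂ V} {φ' : ℂ → V}
    (h : ∀ t, HasWeakDerivAt φ (φ' t) t) (hM : ∀ t, φ' t ∈ M) (a b : ℂ) : φ a - φ b ∈ M := by
  by_contra hab
  obtain ⟨l, hl, hlM⟩ := Submodule.exists_le_ker_of_notMem hab
  refine hl ?_
  rw [map_sub, sub_eq_zero]
  refine is_const_of_deriv_eq_zero (fun t => (h t l).differentiableAt) (fun t => ?_) a b
  rw [(h t l).deriv]
  exact hlM (hM t)

end HasWeakDerivAt

end WeakCalculus

section Calculus

variable {n : ℕ} {V : Type*} [AddCommGroup V] [Module ℂ V]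
  {W : Type*} [AddCommGroup W] [Module ℂ W] {X : Type*} [AddCommGroup X] [Module ℂ X]
  {O : Set (Fin n → ℂ)} {j : Fin n} {s : Fin n → ℂ}

lemma eventually_update_mem (hO : IsOpen O) (hs : s ∈ O) (j : Fin n) :
    ∀ᶠ t in nhds (s j), Function.update s j t ∈ O :=
  (continuous_const.update j continuous_id).continuousAt.preimage_mem_nhds
    (hO.mem_nhds (by simpa using hs))

namespace HasPartial

lemma unique {f : (Fin n → ℂ) → V} {w w' : V} (h : HasPartial j f s w)
    (h' : HasPartial j f s w') : w = w' := HasWeakDerivAt.unique h h'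

lemma congr_of_eqOn {f g : (Fin n → ℂ) → V} {w : V} (h : HasPartial j f s w) (hO : IsOpen O)
    (hs : s ∈ O) (hfg : Set.EqOn g f O) : HasPartial j g s w :=
  HasWeakDerivAt.congr_of_eventuallyEq h ((eventually_update_mem hO hs j).mono fun _ ht => hfg ht)

lemma linear {f : (Fin n → ℂ) → V} {w : V} (h : HasPartial j f s w) (L : V →ₗ[ℂ] W) :
    HasPartial j (fun z => L (f z)) s (L w) := HasWeakDerivAt.linear h L

lemma const (c : V) : HasPartial j (fun _ => c) s 0 := HasWeakDerivAt.const c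

lemma add {f g : (Fin n → ℂ) → V} {w w' : V} (h : HasPartial j f s w)
    (h' : HasPartial j g s w') : HasPartial j (fun z => f z + g z) s (w + w') :=
  HasWeakDerivAt.add h h'

lemma sum {ι : Type*} {S : Finset ι} {f : ι → (Fin n → ℂ) → V} {w : ι → V}
    (h : ∀ i ∈ S, HasPartial j (f i) s (w i)) :
    HasPartial j (fun z => ∑ i ∈ S, f i z) s (∑ i ∈ S, w i) := HasWeakDerivAt.sum h

lemma bilin [Module.Finite ℂ V] [Module.Finite ℂ W] (B : V →ₗ[ℂ] W →ₗ[ℂ] X)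
    {f : (Fin n → ℂ) → V} {g : (Fin n → ℂ) → W} {v : V} {w : W}
    (hf : HasPartial j f s v) (hg : HasPartial j g s w) :
    HasPartial j (fun z => B (f z) (g z)) s (B v (g s) + B (f s) w) := by
  have h := HasWeakDerivAt.bilin B hf hg
  rw [Function.update_eq_self] at h
  exact h

lemma mul {A : Type*} [Ring A] [Algebra ℂ A] [Module.Finite ℂ A] {f g : (Fin n → ℂ) → A}
    {v w : A} (hf : HasPartial j f s v) (hg : HasPartial j g s w) :
    HasPartial j (fun z => f z * g z) s (v * g s + f s * w) :=
  bilin (LinearMap.mul ℂ A) hf hg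

lemma mem_of_forall_mem {f : (Fin n → ℂ) → V} {w : V} {M : Submodule ℂ V}
    (h : HasPartial j f s w) (hO : IsOpen O) (hs : s ∈ O) (hf : ∀ z ∈ O, f z ∈ M) : w ∈ M :=
  HasWeakDerivAt.mem_of_eventually_mem h ((eventually_update_mem hO hs j).mono fun _ ht => hf _ ht)

lemma comp_expMap {f : (Fin n → ℂ) → V} {w : V} {z : Fin n → ℂ}
    (h : HasPartial j f (expMap z) w) :
    HasPartial j (fun z => f (expMap z)) z ((2 * Real.pi * Complex.I * expMap z j) • w) := by
  intro l
  have hupdate : ∀ t, expMap (Function.update z j t) =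
      Function.update (expMap z) j (Complex.exp (2 * Real.pi * Complex.I * t)) := fun t => by
    ext i
    rcases eq_or_ne i j with rfl | hi
    · simp [expMap]
    · simp [expMap, hi]
  have hexp : HasDerivAt (fun t : ℂ => Complex.exp (2 * Real.pi * Complex.I * t))
      (2 * Real.pi * Complex.I * expMap z j) (z j) := by
    simpa [expMap, mul_comm] using
      ((hasDerivAt_id (z j)).const_mul (2 * Real.pi * Complex.I)).cexp
  simp only [hupdate, map_smul, smul_eq_mul, mul_comm _ (l w)]
  exact HasDerivAt.comp (z j) (h l) hexp

end HasPartial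

lemma hasPartial_sum_coord_smul (j : Fin n) (z : Fin n → ℂ) (c : Fin n → V) :
    HasPartial j (fun z => ∑ i, z i • c i) z (c j) := by
  have hsum : HasPartial j (fun z : Fin n → ℂ => ∑ i, z i • c i) z
      (∑ i, (Pi.single j 1 : Fin n → ℂ) i • c i) :=
    HasPartial.sum fun i _ => HasWeakDerivAt.smul_const
      (hasDerivAt_pi.1 (hasDerivAt_update z j (z j)) i) (c i)
  simpa [Pi.single_apply] using hsum

namespace IsHol

lemma mono {O' : Set (Fin n → ℂ)} {f : (Fin n → ℂ) → V} (h : IsHol O f) (hO : O' ⊆ O) :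
    IsHol O' f := fun l => (h l).mono hO

lemma congr {f g : (Fin n → ℂ) → V} (h : IsHol O f) (hfg : Set.EqOn g f O) : IsHol O g :=
  fun l => (h l).congr fun z hz => by simp only [hfg hz]

lemma linear {f : (Fin n → ℂ) → V} (h : IsHol O f) (L : V →ₗ[ℂ] W) :
    IsHol O (fun z => L (f z)) := fun l => h (l ∘ₗ L)

lemma const (c : V) : IsHol O (fun _ => c) := fun l => differentiableOn_const (l c)

lemma smul_const {c : (Fin n → ℂ) → ℂ} (h : DifferentiableOn ℂ c O) (v : V) :
    IsHol O (fun z => c z • v) := fun l => by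
  simpa using h.mul_const (l v)

lemma add {f g : (Fin n → ℂ) → V} (h : IsHol O f) (h' : IsHol O g) :
    IsHol O (fun z => f z + g z) := fun l => by
  simp only [map_add]
  exact (h l).add (h' l)

lemma sum {ι : Type*} {S : Finset ι} {f : ι → (Fin n → ℂ) → V} (h : ∀ i ∈ S, IsHol O (f i)) :
    IsHol O (fun z => ∑ i ∈ S, f i z) := fun l => by
  simpa only [map_sum] using DifferentiableOn.fun_sum fun i hi => h i hi l

lemma bilin [Module.Finite ℂ V] [Module.Finite ℂ W] (B : V →ₗ[ℂ] W →ₗ[ℂ] X)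
    {f : (Fin n → ℂ) → V} {g : (Fin n → ℂ) → W} (hf : IsHol O f) (hg : IsHol O g) :
    IsHol O (fun z => B (f z) (g z)) := by
  intro l
  have hcoord := eq_sum_dualBasis_mul_of_bilin (Module.finBasis ℂ V) (Module.finBasis ℂ W)
    (B.compr₂ l)
  simp only [LinearMap.compr₂_apply] at hcoord
  rw [funext fun z => hcoord (f z) (g z)]
  exact DifferentiableOn.fun_sum fun i _ => DifferentiableOn.fun_sum fun k _ =>
    ((hf _).mul (hg _)).const_mul _

lemma mul {A : Type*} [Ring A] [Algebra ℂ A] [Module.Finite ℂ A] {f g : (Fin n → ℂ) → A}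
    (hf : IsHol O f) (hg : IsHol O g) : IsHol O (fun z => f z * g z) :=
  bilin (LinearMap.mul ℂ A) hf hg

lemma pow {A : Type*} [Ring A] [Algebra ℂ A] [Module.Finite ℂ A] {f : (Fin n → ℂ) → A}
    (hf : IsHol O f) (k : ℕ) : IsHol O (fun z => f z ^ k) := by
  induction k with
  | zero => simpa using const (1 : A)
  | succ k ih => simpa only [pow_succ] using ih.mul hf

lemma comp_expMap {f : (Fin n → ℂ) → V} (h : IsHol O f) :
    IsHol (expMap ⁻¹' O) (fun z => f (expMap z)) := fun l =>
  (h l).comp (by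
    unfold expMap
    fun_prop : Differentiable ℂ (expMap : (Fin n → ℂ) → _)).differentiableOn fun _ hz => hz

end IsHol

variable [Module.Finite ℂ V] {f : (Fin n → ℂ) → V}

/-- The partial derivative of a holomorphic map with values in a finite dimensional vector space,
computed in a basis. -/
noncomputable def partialDeriv (j : Fin n) (f : (Fin n → ℂ) → V) (s : Fin n → ℂ) : V :=
  ∑ i, fderiv ℂ (fun z => (Module.finBasis ℂ V).coord i (f z)) s (Pi.single j 1) •
    Module.finBasis ℂ V i

lemma dual_partialDeriv (hf : IsHol O f) (hO : IsOpen O) (hs : s ∈ O) (l : Module.Dual ℂ V) :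
    l (partialDeriv j f s) = fderiv ℂ (fun z => l (f z)) s (Pi.single j 1) := by
  set b := Module.finBasis ℂ V with hb
  have hl : (fun z => l (f z)) = fun z => ∑ i, b.coord i (f z) * l (b i) := by
    funext z
    conv_lhs => rw [← b.sum_repr (f z), map_sum]
    simp only [map_smul, smul_eq_mul, Module.Basis.coord_apply]
  have hcoord : ∀ i, HasFDerivAt (fun z => b.coord i (f z) * l (b i))
      (l (b i) • fderiv ℂ (fun z => b.coord i (f z)) s) s := fun i =>
    ((hf (b.coord i)).differentiableAt (hO.mem_nhds hs)).hasFDerivAt.mul_const _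
  rw [hl, partialDeriv, map_sum,
    (HasFDerivAt.fun_sum fun i (_ : i ∈ Finset.univ) => hcoord i).fderiv]
  simp [hb, mul_comm]

lemma IsHol.hasPartial (hf : IsHol O f) (hO : IsOpen O) (hs : s ∈ O) (j : Fin n) :
    HasPartial j f s (partialDeriv j f s) := by
  intro l
  rw [dual_partialDeriv hf hO hs]
  have hl : HasFDerivAt (fun z => l (f z)) (fderiv ℂ (fun z => l (f z)) s)
      (Function.update s j (s j)) := by
    rw [Function.update_eq_self]
    exact ((hf l).differentiableAt (hO.mem_nhds hs)).hasFDerivAt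
  exact hl.comp_hasDerivAt (s j) (hasDerivAt_update s j (s j))

lemma IsHol.partialDeriv (hf : IsHol O f) (hO : IsOpen O) (j : Fin n) :
    IsHol O (partialDeriv j f) := fun l =>
  (differentiableOn_fderiv_apply hO (hf l) (Pi.single j 1)).congr fun _ hz =>
    dual_partialDeriv hf hO hz l

lemma partialDeriv_comm (hf : IsHol O f) (hO : IsOpen O) (hs : s ∈ O) (i j : Fin n) :
    partialDeriv i (partialDeriv j f) s = partialDeriv j (partialDeriv i f) s := by
  refine sub_eq_zero.1 ((Module.forall_dual_apply_eq_zero_iff ℂ _).1 fun l => ?_)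
  have hfderiv : ∀ i j : Fin n, l (partialDeriv i (partialDeriv j f) s) =
      fderiv ℂ (fun z => fderiv ℂ (fun z => l (f z)) z (Pi.single j 1)) s (Pi.single i 1) := by
    intro i j
    rw [dual_partialDeriv (hf.partialDeriv hO j) hO hs]
    congr 1
    refine Filter.EventuallyEq.fderiv_eq ?_
    filter_upwards [hO.mem_nhds hs] with z hz using dual_partialDeriv hf hO hz l
  rw [map_sub, hfderiv, hfderiv, fderiv_fderiv_apply_comm hO (hf l) hs, sub_self]

end Calculus

/-! ### The derivative of the exponential -/

section ExpDerivative

lemma hasWeakDerivAt_sum_pow_smul {V : Type*} [AddCommGroup V] [Module ℂ V] (a : ℕ → V) (N : ℕ)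
    (t : ℂ) :
    HasWeakDerivAt (fun t => ∑ i ∈ Finset.range (N + 1), (t ^ i * (i.factorial : ℂ)⁻¹) • a i)
      (∑ i ∈ Finset.range N, (t ^ i * (i.factorial : ℂ)⁻¹) • a (i + 1)) t := by
  have hterm : ∀ i ∈ Finset.range (N + 1),
      HasWeakDerivAt (fun t => (t ^ i * (i.factorial : ℂ)⁻¹) • a i)
        ((i * t ^ (i - 1) * (i.factorial : ℂ)⁻¹) • a i) t := fun i _ =>
    .smul_const ((hasDerivAt_pow i t).mul_const _) _
  convert HasWeakDerivAt.sum hterm using 1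
  rw [Finset.sum_range_succ']
  simp only [Nat.cast_zero, zero_mul, zero_smul, add_zero, Nat.add_sub_cancel]
  refine Finset.sum_congr rfl fun i _ => ?_
  have hi : ((i : ℂ) + 1) ≠ 0 := Nat.cast_add_one_ne_zero i
  congr 1
  rw [Nat.factorial_succ]
  push_cast
  field_simp

/-- The derivative of `f ↦ f ^ i` at `x` in the direction `y`, in an algebra which need not be
commutative. -/
def powDeriv {A : Type*} [Ring A] (x y : A) : ℕ → A
  | 0 => 0
  | i + 1 => y * x ^ i + x * powDeriv x y i

section Algebra

variable {A : Type*} [Ring A] [Algebra ℂ A] [Module ℚ A]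

lemma exp_smul_eq_sum_complex {x : A} {N : ℕ} (hx : x ^ N = 0) (t : ℂ) :
    IsNilpotent.exp (t • x) =
      ∑ i ∈ Finset.range N, (t ^ i * (i.factorial : ℂ)⁻¹) • x ^ i := by
  rw [exp_eq_sum_complex (k := N) (by rw [smul_pow, hx, smul_zero])]
  refine Finset.sum_congr rfl fun i _ => ?_
  rw [smul_pow, smul_smul, mul_comm]

lemma hasWeakDerivAt_exp_smul {x : A} (hx : IsNilpotent x) (t : ℂ) :
    HasWeakDerivAt (fun t : ℂ => IsNilpotent.exp (t • x)) (IsNilpotent.exp (t • x) * x) t := by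
  obtain ⟨N, hN⟩ := hx
  convert hasWeakDerivAt_sum_pow_smul (fun i => x ^ i) N t using 1
  · exact funext fun t => exp_smul_eq_sum_complex (pow_eq_zero_of_le N.le_succ hN) t
  · simp only [exp_smul_eq_sum_complex hN, Finset.sum_mul, smul_mul_assoc, pow_succ]

lemma exp_neg_mul_sum_powDeriv_sub_mem [Module.Finite ℂ A] {x y z : A} {N : ℕ} (hx : x ^ N = 0)
    (hy : powDeriv x y N = 0) {M : Submodule ℂ A}
    (hM : ∀ t : ℂ, IsNilpotent.exp (t • -x) * y * IsNilpotent.exp (t • x) - z ∈ M) :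
    IsNilpotent.exp (-x) * ∑ i ∈ Finset.range N, (i.factorial : ℂ)⁻¹ • powDeriv x y i - z ∈ M := by
  set E : ℂ → A := fun t =>
    ∑ i ∈ Finset.range (N + 1), (t ^ i * (i.factorial : ℂ)⁻¹) • powDeriv x y i with hE
  have hE' : ∀ t, HasWeakDerivAt E (y * IsNilpotent.exp (t • x) + x * E t) t := fun t => by
    convert hasWeakDerivAt_sum_pow_smul (powDeriv x y) N t using 1
    simp only [hE, Finset.sum_range_succ, hy, smul_zero, add_zero, exp_smul_eq_sum_complex hx,
      powDeriv, smul_add, Finset.sum_add_distrib, Finset.mul_sum, mul_smul_comm]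
  have hnil : IsNilpotent (-x) := IsNilpotent.neg ⟨N, hx⟩
  have hφ : ∀ t, HasWeakDerivAt (fun t => IsNilpotent.exp (t • -x) * E t - t • z)
      (IsNilpotent.exp (t • -x) * y * IsNilpotent.exp (t • x) - z) t := fun t => by
    convert ((hasWeakDerivAt_exp_smul hnil t).mul (hE' t)).sub
      (.smul_const (hasDerivAt_id' t) z) using 1
    rw [one_smul]
    noncomm_ring
  have hE0 : E 0 = 0 := by simp [hE, Finset.sum_range_succ', powDeriv]
  have hE1 : E 1 = ∑ i ∈ Finset.range N, (i.factorial : ℂ)⁻¹ • powDeriv x y i := by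
    simp [hE, Finset.sum_range_succ, hy]
  simpa [hE0, hE1] using HasWeakDerivAt.sub_mem_of_forall_mem hφ hM 1 0

end Algebra

variable {n : ℕ} {V : Type u} [AddCommGroup V] [Module ℂ V] [Module.Finite ℂ V]
  {O : Set (Fin n → ℂ)} {j : Fin n} {s : Fin n → ℂ} {f : (Fin n → ℂ) → Module.End ℂ V}

lemma pow_finrank_eq_zero {x : Module.End ℂ V} (hx : IsNilpotent x) :
    x ^ Module.finrank ℂ V = 0 := by
  have hchar := LinearMap.aeval_self_charpoly x
  rwa [hx.charpoly_eq_X_pow_finrank, map_pow, Polynomial.aeval_X] at hchar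

lemma HasPartial.pow {A : Type*} [Ring A] [Algebra ℂ A] [Module.Finite ℂ A]
    {f : (Fin n → ℂ) → A} {y : A} (h : HasPartial j f s y) (i : ℕ) :
    HasPartial j (fun z => f z ^ i) s (powDeriv (f s) y i) := by
  induction i with
  | zero => simpa [powDeriv] using HasPartial.const (1 : A)
  | succ i ih =>
    simp only [pow_succ']
    exact h.mul ih

variable [Module ℚ (Module.End ℂ V)]

lemma IsHol.exp (h : IsHol O f) (hf : ∀ z ∈ O, IsNilpotent (f z)) :
    IsHol O (fun z => IsNilpotent.exp (f z)) :=
  (IsHol.sum (S := Finset.range (Module.finrank ℂ V)) fun i _ =>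
    (h.pow i).linear ((i.factorial : ℂ)⁻¹ • LinearMap.id)).congr fun z hz =>
      exp_eq_sum_complex (pow_finrank_eq_zero (hf z hz))

/-- In the integral formula `e^{-x} D = ∫₀¹ e^{-tx} y e^{tx} dt` for the derivative `D` of `e^x`
in the direction `y`, the integrand is congruent to `y` modulo `M`. -/
lemma HasPartial.exp_neg_mul_sub_mem [Module ℚ (Module.End ℂ (Module.End ℂ V))]
    {y D : Module.End ℂ V} (h : HasPartial j f s y)
    (hD : HasPartial j (fun z => IsNilpotent.exp (f z)) s D) (hO : IsOpen O) (hs : s ∈ O)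
    (hf : ∀ z ∈ O, IsNilpotent (f z)) {M : Submodule ℂ (Module.End ℂ V)}
    (hM : ∀ z ∈ M, f s * z - z * f s ∈ M) (hy : f s * y - y * f s ∈ M) :
    IsNilpotent.exp (-f s) * D - y ∈ M := by
  set N := Module.finrank ℂ V
  have hpow : ∀ z ∈ O, f z ^ N = 0 := fun z hz => pow_finrank_eq_zero (hf z hz)
  have hpowDeriv : powDeriv (f s) y N = 0 :=
    (h.pow N).unique ((HasPartial.const (0 : Module.End ℂ V)).congr_of_eqOn hO hs hpow)
  have hDsum : D = ∑ i ∈ Finset.range N, (i.factorial : ℂ)⁻¹ • powDeriv (f s) y i :=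
    hD.unique <| (HasPartial.sum fun i _ =>
      (h.pow i).linear ((i.factorial : ℂ)⁻¹ • LinearMap.id)).congr_of_eqOn hO hs fun z hz =>
        exp_eq_sum_complex (hpow z hz)
  rw [hDsum]
  refine exp_neg_mul_sum_powDeriv_sub_mem (hpow s hs) hpowDeriv fun t => ?_
  have had : ∀ w, (t • f s) * w - w * (t • f s) = t • (f s * w - w * f s) := fun w => by
    rw [smul_mul_assoc, mul_smul_comm, smul_sub]
  have hconj := exp_neg_adEnd_sub_mem (M := M) (y := y) ((hf s hs).smul t)
    (fun z hz => by rw [had]; exact M.smul_mem t (hM z hz))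
    (by rw [had]; exact M.smul_mem t hy)
  rwa [exp_neg_adEnd_apply ((hf s hs).smul t), ← smul_neg] at hconj

end ExpDerivative

lemma commute_of_hasPartial_mul {n : ℕ} {A : Type*} [Ring A] [Algebra ℂ A] [Module.Finite ℂ A]
    {O : Set (Fin n → ℂ)} (hO : IsOpen O) {g : (Fin n → ℂ) → A} {ω : Fin n → (Fin n → ℂ) → A}
    (hω : ∀ j, IsHol O (ω j)) (hg : ∀ z ∈ O, ∀ j, HasPartial j g z (g z * ω j z))
    (hgO : IsHol O g) {s : Fin n → ℂ} (hs : s ∈ O) (hgs : IsUnit (g s)) {i j : Fin n}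
    (hclosed : partialDeriv i (ω j) s = partialDeriv j (ω i) s) : Commute (ω i s) (ω j s) := by
  have hsecond : ∀ i j, partialDeriv i (partialDeriv j g) s =
      g s * ω i s * ω j s + g s * partialDeriv i (ω j) s := fun i j => by
    have hfirst : Set.EqOn (partialDeriv j g) (fun z => g z * ω j z) O := fun z hz =>
      (hgO.hasPartial hO hz j).unique (hg z hz j)
    exact ((hgO.partialDeriv hO j).hasPartial hO hs i).unique
      (((hg s hs i).mul ((hω j).hasPartial hO hs i)).congr_of_eqOn hO hs hfirst)
  have hsymm := partialDeriv_comm hgO hO hs i j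
  rw [hsecond, hsecond, hclosed, add_left_inj, mul_assoc, mul_assoc] at hsymm
  exact hgs.mul_left_cancel hsymm

/-! ### The punctured polydisk -/

section Domains

variable {n : ℕ}

lemma isOpen_polydisk (r : ℝ) : IsOpen (polydisk n r) := by
  have hinter : polydisk n r = ⋂ j, {s | ‖s j‖ < r} := by
    ext
    simp [polydisk]
  rw [hinter]
  exact isOpen_iInter_of_finite fun j => isOpen_lt (by fun_prop) continuous_const

lemma isOpen_puncturedPolydisk (r : ℝ) : IsOpen (puncturedPolydisk n r) := by
  have hinter : puncturedPolydisk n r = ⋂ j, ({s | s j ≠ 0} ∩ {s | ‖s j‖ < r}) := by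
    ext
    simp [puncturedPolydisk]
  rw [hinter]
  exact isOpen_iInter_of_finite fun j =>
    (isOpen_ne_fun (by fun_prop) continuous_const).inter (isOpen_lt (by fun_prop) continuous_const)

lemma isOpen_expMap_preimage_puncturedPolydisk (r : ℝ) :
    IsOpen (expMap ⁻¹' puncturedPolydisk n r) := by
  refine (isOpen_puncturedPolydisk r).preimage ?_
  unfold expMap
  fun_prop

lemma puncturedPolydisk_subset (r : ℝ) : puncturedPolydisk n r ⊆ polydisk n r :=
  fun _ hs j => (hs j).2

lemma polydisk_subset {r : ℝ} (hr : r ≤ 1) : polydisk n r ⊆ polydisk n 1 :=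
  fun _ hs j => (hs j).trans_le hr

lemma mem_upperHalf_of_expMap_mem {r : ℝ} (hr : r ≤ 1) {z : Fin n → ℂ}
    (hz : expMap z ∈ puncturedPolydisk n r) : z ∈ upperHalf n := by
  intro j
  have hnorm := (hz j).2.trans_le hr
  rw [norm_expMap, Real.exp_lt_one_iff] at hnorm
  by_contra him
  nlinarith [Real.two_pi_pos]

lemma exists_expMap_eq {s : Fin n → ℂ} (hs : ∀ j, s j ≠ 0) : ∃ z, expMap z = s := by
  refine ⟨fun j => Complex.log (s j) / (2 * Real.pi * Complex.I), funext fun j => ?_⟩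
  rw [expMap, mul_div_cancel₀ _ Complex.two_pi_I_ne_zero, Complex.exp_log (hs j)]

lemma two_pi_I_mul_ne_zero {r : ℝ} {s : Fin n → ℂ} (hs : s ∈ puncturedPolydisk n r)
    (j : Fin n) : 2 * Real.pi * Complex.I * s j ≠ 0 :=
  mul_ne_zero Complex.two_pi_I_ne_zero (hs j).1

end Domains

/-! ### The logarithmic derivative of the period map -/

lemma isDeligneBigrading_deligneBigrading {H : Type u} [AddCommGroup H] [Module ℚ H]
    {F : ℤ → Submodule ℂ (ℂ ⊗[ℚ] H)} {W : ℤ → Submodule ℚ H}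
    (h : ∃ I, IsDeligneBigrading F W I) : IsDeligneBigrading F W (deligneBigrading F W) := by
  rw [deligneBigrading, dif_pos h]
  exact h.choose_spec

namespace VGPMHS

variable {n : ℕ} {𝒱 : VGPMHS.{u} n} {ψ : ℤ → (Fin n → ℂ) → Submodule ℂ 𝒱.V} {r : ℝ}
  {Γ : (Fin n → ℂ) → Module.End ℂ 𝒱.V}

instance : Module.Finite ℚ 𝒱.VQ := 𝒱.finite _

section Grading

variable {Finf : ℤ → Submodule ℂ 𝒱.V}

lemma isInternal_UInf (h : ∃ I, IsDeligneBigrading Finf 𝒱.relW I) :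
    DirectSum.IsInternal (𝒱.UInf Finf) :=
  (isDeligneBigrading_deligneBigrading h).isInternal_iSup

lemma hodge_eq_iSup_UInf (h : ∃ I, IsDeligneBigrading Finf 𝒱.relW I) (p : ℤ) :
    Finf p = ⨆ (r : ℤ) (_ : p ≤ r), 𝒱.UInf Finf r :=
  (isDeligneBigrading_deligneBigrading h).hodge p

/-- By the convention in `deligneBigrading`, the `U^p` vanish if there is no Deligne bigrading, so
that every endomorphism is homogeneous of every degree. -/
lemma glGraded_UInf_eq_top (h : ¬ ∃ I, IsDeligneBigrading Finf 𝒱.relW I) (a : ℤ) :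
    glGraded (𝒱.UInf Finf) a = ⊤ := by
  have hbot : 𝒱.UInf Finf = fun _ => ⊥ := by
    funext p
    simp [UInf, hodgeU, deligneBigrading, dif_neg h]
  refine eq_top_iff.2 fun α _ p x hx => ?_
  rw [hbot, Submodule.mem_bot] at hx
  rw [hx, map_zero]
  exact Submodule.zero_mem _

lemma wp_le_qInf : 𝒱.wp Finf (-1) ≤ 𝒱.qInf Finf := le_negPart (by norm_num)

lemma qInf_le_glBelow : 𝒱.qInf Finf ≤ glBelow (𝒱.UInf Finf) (-1) := negPart_le_glBelow

lemma commutator_mem_qInf {α β : Module.End ℂ 𝒱.V} (hα : α ∈ 𝒱.qInf Finf)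
    (hβ : β ∈ 𝒱.qInf Finf) : α * β - β * α ∈ 𝒱.qInf Finf :=
  commutator_mem_negPart (fun _ h _ h' => commutator_mem_lieG h h') hα hβ

lemma commutator_mem_glBelow_neg_two {α β : Module.End ℂ 𝒱.V} (hα : α ∈ 𝒱.qInf Finf)
    (hβ : β ∈ glBelow (𝒱.UInf Finf) (-1)) :
    α * β - β * α ∈ glBelow (𝒱.UInf Finf) (-2) := by
  rw [show (-2 : ℤ) = -1 + -1 by norm_num]
  exact commutator_mem_glBelow (qInf_le_glBelow hα) hβ

lemma mem_wp_of_map_hodge_le {α : Module.End ℂ 𝒱.V} (hα : α ∈ 𝒱.qInf Finf)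
    (hF : ∀ p, ∀ x ∈ Finf p, α x ∈ Finf (p - 1)) : α ∈ 𝒱.wp Finf (-1) := by
  refine ⟨negPart_le_self hα, ?_⟩
  by_cases h : ∃ I, IsDeligneBigrading Finf 𝒱.relW I
  · refine mem_glGraded_neg_one_of_shift (isInternal_UInf h) (qInf_le_glBelow hα) fun p x hx => ?_
    rw [← hodge_eq_iSup_UInf h] at hx ⊢
    exact hF p x hx
  · rw [glGraded_UInf_eq_top h]
    exact Submodule.mem_top

open Classical in
/-- The projection of `gl(V)` to its part of degree `-1`; without a Deligne bigrading, where every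
endomorphism is a component of every other one, it is taken to be `0`. -/
noncomputable def negOneProj (𝒱 : VGPMHS.{u} n) (Finf : ℤ → Submodule ℂ 𝒱.V) :
    Module.End ℂ 𝒱.V →ₗ[ℂ] Module.End ℂ 𝒱.V :=
  if h : ∃ I, IsDeligneBigrading Finf 𝒱.relW I then glProj (isInternal_UInf h) (-1) else 0

lemma negOneProj_eq (h : ∃ I, IsDeligneBigrading Finf 𝒱.relW I) :
    𝒱.negOneProj Finf = glProj (isInternal_UInf h) (-1) := dif_pos h

lemma negOneProj_mem_wp {α : Module.End ℂ 𝒱.V} (hα : α ∈ 𝒱.qInf Finf) :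
    𝒱.negOneProj Finf α ∈ 𝒱.wp Finf (-1) := by
  rw [negOneProj]
  split_ifs with h
  · exact ⟨(glProj_mem_of_mem_negPart _ hα).1, glProj_mem _ _ α⟩
  · exact Submodule.zero_mem _

lemma sub_negOneProj_mem_glBelow {α : Module.End ℂ 𝒱.V} (hα : α ∈ 𝒱.qInf Finf) :
    α - 𝒱.negOneProj Finf α ∈ glBelow (𝒱.UInf Finf) (-2) := by
  by_cases h : ∃ I, IsDeligneBigrading Finf 𝒱.relW I
  · rw [negOneProj_eq h]
    exact (glProj_mem_of_mem_negPart _ hα).2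
  · refine glGraded_le_glBelow le_rfl ?_
    rw [glGraded_UInf_eq_top h]
    exact Submodule.mem_top

lemma isComponent_negOneProj {α : Module.End ℂ 𝒱.V} (hα : α ∈ 𝒱.qInf Finf) :
    IsComponent (𝒱.UInf Finf) (-1) α (𝒱.negOneProj Finf α) :=
  isComponent_of_sub_mem_glBelow (by norm_num) (negOneProj_mem_wp hα).2
    (sub_negOneProj_mem_glBelow hα)

end Grading

namespace IsAdmissible

lemma commute_N (hψ : 𝒱.IsAdmissible ψ) (i j : Fin n) : Commute (𝒱.N i) (𝒱.N j) :=
  (hψ.imhm.commute i j).map (Module.End.baseChangeHom ℚ ℂ 𝒱.VQ)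

lemma isNilpotent_N (hψ : 𝒱.IsAdmissible ψ) (j : Fin n) : IsNilpotent (𝒱.N j) :=
  (hψ.imhm.nilpotent j).map (Module.End.baseChangeHom ℚ ℂ 𝒱.VQ)

lemma isNilpotent_sum_smul_N (hψ : 𝒱.IsAdmissible ψ) (z : Fin n → ℂ) :
    IsNilpotent (∑ j, z j • 𝒱.N j) :=
  Commute.isNilpotent_sum (fun j _ => (hψ.isNilpotent_N j).smul (z j))
    fun i j _ _ => ((hψ.commute_N i j).smul_left (z i)).smul_right (z j)

lemma commute_sum_smul_N (hψ : 𝒱.IsAdmissible ψ) (z : Fin n → ℂ) (j : Fin n) :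
    Commute (∑ i, z i • 𝒱.N i) (𝒱.N j) :=
  Commute.sum_left _ _ _ fun i _ => (hψ.commute_N i j).smul_left (z i)

lemma N_mem_wp (hψ : 𝒱.IsAdmissible ψ) (j : Fin n) : 𝒱.N j ∈ 𝒱.wp (fun p => ψ p 0) (-1) := by
  refine ⟨hψ.imhm.isometry j, ?_⟩
  by_cases h : ∃ I, IsDeligneBigrading (fun p => ψ p 0) 𝒱.relW I
  · exact (isDeligneBigrading_deligneBigrading h).mem_glGraded (hψ.imhm.hodge_shift j)
      (hψ.imhm.relative_shift Finset.univ j (Finset.mem_univ j))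
  · rw [glGraded_UInf_eq_top h]
    exact Submodule.mem_top

lemma sum_smul_N_mem_wp (hψ : 𝒱.IsAdmissible ψ) (z : Fin n → ℂ) :
    ∑ j, z j • 𝒱.N j ∈ 𝒱.wp (fun p => ψ p 0) (-1) :=
  Submodule.sum_mem _ fun j _ => Submodule.smul_mem _ _ (hψ.N_mem_wp j)

lemma Omega_mem_wp (hψ : 𝒱.IsAdmissible ψ) (j : Fin n) (s : Fin n → ℂ) :
    𝒱.Omega j s ∈ 𝒱.wp (fun p => ψ p 0) (-1) := Submodule.smul_mem _ _ (hψ.N_mem_wp j)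

lemma isHol_expN (hψ : 𝒱.IsAdmissible ψ) : IsHol Set.univ 𝒱.expN :=
  IsHol.exp (IsHol.sum fun i _ => IsHol.smul_const (by fun_prop) (𝒱.N i))
    fun w _ => hψ.isNilpotent_sum_smul_N w

lemma hasPartial_expN (hψ : 𝒱.IsAdmissible ψ) (z : Fin n → ℂ) (j : Fin n) :
    HasPartial j 𝒱.expN z (𝒱.expN z * 𝒱.N j) := by
  have hD := hψ.isHol_expN.hasPartial isOpen_univ (Set.mem_univ z) j
  have hmem := (hasPartial_sum_coord_smul j z 𝒱.N).exp_neg_mul_sub_mem (M := ⊥) hD isOpen_univ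
    (Set.mem_univ z) (fun w _ => hψ.isNilpotent_sum_smul_N w) (by simp)
    (by simp [(hψ.commute_sum_smul_N z j).eq])
  rw [Submodule.mem_bot, sub_eq_zero] at hmem
  rwa [← hmem, ← mul_assoc, expN, IsNilpotent.exp_mul_exp_neg_self (hψ.isNilpotent_sum_smul_N z),
    one_mul]

end IsAdmissible

lemma smul_Omega {s : Fin n → ℂ} (hs : s ∈ puncturedPolydisk n r) (j : Fin n) :
    (2 * Real.pi * Complex.I * s j) • 𝒱.Omega j s = 𝒱.N j := by
  rw [Omega, smul_inv_smul₀ (two_pi_I_mul_ne_zero hs j)]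

lemma isHol_Omega (j : Fin n) : IsHol (puncturedPolydisk n r) (𝒱.Omega j) :=
  IsHol.smul_const (DifferentiableOn.inv (by fun_prop) fun _ hs => two_pi_I_mul_ne_zero hs j) _

/-- The coefficient of `ds_j` in the 1-form `e^{-ad Γ} Ω + e^{-Γ} ∂e^Γ`. -/
noncomputable def logForm (Γ : (Fin n → ℂ) → Module.End ℂ 𝒱.V) (j : Fin n) (s : Fin n → ℂ) :
    Module.End ℂ 𝒱.V :=
  IsNilpotent.exp (-adEnd (Γ s)) (𝒱.Omega j s) +
    IsNilpotent.exp (-Γ s) * partialDeriv j (fun s => IsNilpotent.exp (Γ s)) s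

/-- The frame `e^{∑ z_j N_j} e^{Γ(s)}`, `s = e^{2πiz}`, which maps `F_∞` to the period map. -/
noncomputable def frame (Γ : (Fin n → ℂ) → Module.End ℂ 𝒱.V) (z : Fin n → ℂ) :
    Module.End ℂ 𝒱.V :=
  𝒱.expN z * IsNilpotent.exp (Γ (expMap z))

namespace IsPeriodLog

/-- `IsNilpotent.exp` is `0` at an endomorphism which is not nilpotent, and `0` does not map `F_∞`
onto `ψ s` unless `V = 0`. -/
lemma isNilpotent (hΓ : 𝒱.IsPeriodLog ψ r Γ) (hψ : 𝒱.IsAdmissible ψ) (hr : r ≤ 1)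
    {s : Fin n → ℂ} (hs : s ∈ polydisk n r) : IsNilpotent (Γ s) := by
  by_contra hn
  have hclass : nilpotencyClass (Γ s) = 0 := by
    by_contra h
    exact hn (isNilpotent_of_pos_nilpotencyClass (Nat.pos_of_ne_zero h))
  have hexp : IsNilpotent.exp (Γ s) = 0 := by
    rw [IsNilpotent.exp, hclass, Finset.sum_range_zero]
  obtain ⟨p, hp⟩ := (hψ.filtration s (polydisk_subset hr hs)).eq_top
  have htop := hΓ.eq s hs p
  rw [hexp, Submodule.map_zero, hp] at htop
  have : Subsingleton 𝒱.V := (Submodule.subsingleton_iff ℂ).1 (subsingleton_of_bot_eq_top htop.symm)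
  exact hn (by rw [Subsingleton.elim (Γ s) 0]; exact IsNilpotent.zero)

lemma isHol_exp (hΓ : 𝒱.IsPeriodLog ψ r Γ) (hψ : 𝒱.IsAdmissible ψ) (hr : r ≤ 1) :
    IsHol (polydisk n r) fun s => IsNilpotent.exp (Γ s) :=
  hΓ.holomorphic.exp fun _ hs => hΓ.isNilpotent hψ hr hs

lemma partialDeriv_mem (hΓ : 𝒱.IsPeriodLog ψ r Γ) {s : Fin n → ℂ} (hs : s ∈ polydisk n r)
    (j : Fin n) : partialDeriv j Γ s ∈ 𝒱.qInf (fun p => ψ p 0) :=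
  (hΓ.holomorphic.hasPartial (isOpen_polydisk r) hs j).mem_of_forall_mem (isOpen_polydisk r) hs
    hΓ.mem

lemma logForm_sub_mem (hΓ : 𝒱.IsPeriodLog ψ r Γ) (hψ : 𝒱.IsAdmissible ψ) (hr : r ≤ 1)
    {s : Fin n → ℂ} (hs : s ∈ polydisk n r) (j : Fin n) {M : Submodule ℂ (Module.End ℂ 𝒱.V)}
    (hM : ∀ α ∈ M, Γ s * α - α * Γ s ∈ M)
    (hq : ∀ α ∈ 𝒱.qInf (fun p => ψ p 0), Γ s * α - α * Γ s ∈ M) :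
    logForm Γ j s - (𝒱.Omega j s + partialDeriv j Γ s) ∈ M := by
  have hO := isOpen_polydisk (n := n) r
  have hΩ := exp_neg_adEnd_sub_mem (hΓ.isNilpotent hψ hr hs) hM
    (hq _ (wp_le_qInf (hψ.Omega_mem_wp j s)))
  have hd := (hΓ.holomorphic.hasPartial hO hs j).exp_neg_mul_sub_mem
    ((hΓ.isHol_exp hψ hr).hasPartial hO hs j) hO hs (fun _ => hΓ.isNilpotent hψ hr) hM
    (hq _ (hΓ.partialDeriv_mem hs j))
  rw [logForm, add_sub_add_comm]
  exact M.add_mem hΩ hd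

lemma logForm_mem_qInf (hΓ : 𝒱.IsPeriodLog ψ r Γ) (hψ : 𝒱.IsAdmissible ψ) (hr : r ≤ 1)
    {s : Fin n → ℂ} (hs : s ∈ polydisk n r) (j : Fin n) :
    logForm Γ j s ∈ 𝒱.qInf (fun p => ψ p 0) := by
  have hM := fun α => commutator_mem_qInf (hΓ.mem s hs) (β := α)
  exact (Submodule.sub_mem_iff_left _ (Submodule.add_mem _
    (wp_le_qInf (hψ.Omega_mem_wp j s)) (hΓ.partialDeriv_mem hs j))).1
      (hΓ.logForm_sub_mem hψ hr hs j hM hM)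

lemma isHol_frame (hΓ : 𝒱.IsPeriodLog ψ r Γ) (hψ : 𝒱.IsAdmissible ψ) (hr : r ≤ 1) :
    IsHol (expMap ⁻¹' puncturedPolydisk n r) (frame Γ) :=
  (hψ.isHol_expN.mono (Set.subset_univ _)).mul
    ((hΓ.isHol_exp hψ hr).mono (puncturedPolydisk_subset r)).comp_expMap

lemma isUnit_frame (hΓ : 𝒱.IsPeriodLog ψ r Γ) (hψ : 𝒱.IsAdmissible ψ) (hr : r ≤ 1)
    {z : Fin n → ℂ} (hz : expMap z ∈ puncturedPolydisk n r) : IsUnit (frame Γ z) :=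
  (IsNilpotent.isUnit_exp (hψ.isNilpotent_sum_smul_N z)).mul
    (IsNilpotent.isUnit_exp (hΓ.isNilpotent hψ hr (puncturedPolydisk_subset r hz)))

lemma hasPartial_frame (hΓ : 𝒱.IsPeriodLog ψ r Γ) (hψ : 𝒱.IsAdmissible ψ) (hr : r ≤ 1)
    {z : Fin n → ℂ} (hz : expMap z ∈ puncturedPolydisk n r) (j : Fin n) :
    HasPartial j (frame Γ) z
      (frame Γ z * ((2 * Real.pi * Complex.I * expMap z j) • logForm Γ j (expMap z))) := by
  have hs := puncturedPolydisk_subset r hz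
  have hnil := hΓ.isNilpotent hψ hr hs
  have hexp := ((hΓ.isHol_exp hψ hr).hasPartial (isOpen_polydisk r) hs j).comp_expMap
  have hcancel : IsNilpotent.exp (Γ (expMap z)) * logForm Γ j (expMap z) =
      𝒱.Omega j (expMap z) * IsNilpotent.exp (Γ (expMap z)) +
        partialDeriv j (fun s => IsNilpotent.exp (Γ s)) (expMap z) := by
    rw [logForm, exp_neg_adEnd_apply hnil, mul_assoc, ← mul_add, ← mul_assoc,
      IsNilpotent.exp_mul_exp_neg_self hnil, one_mul]
  have hleibniz : frame Γ z * ((2 * Real.pi * Complex.I * expMap z j) • logForm Γ j (expMap z)) =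
      𝒱.expN z * 𝒱.N j * IsNilpotent.exp (Γ (expMap z)) + 𝒱.expN z *
        ((2 * Real.pi * Complex.I * expMap z j) •
          partialDeriv j (fun s => IsNilpotent.exp (Γ s)) (expMap z)) := by
    rw [frame, mul_assoc (𝒱.expN z), mul_smul_comm _ (IsNilpotent.exp _), hcancel,
      ← smul_Omega hz j]
    simp only [smul_add, mul_add, mul_smul_comm, smul_mul_assoc, mul_assoc]
  rw [hleibniz]
  exact (hψ.hasPartial_expN z j).mul hexp

lemma map_frame (hΓ : 𝒱.IsPeriodLog ψ r Γ) (hψ : 𝒱.IsAdmissible ψ) (hr : r ≤ 1)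
    {z : Fin n → ℂ} (hz : expMap z ∈ puncturedPolydisk n r) (p : ℤ) :
    (ψ p 0).map (frame Γ z) = 𝒱.period p ⟨z, mem_upperHalf_of_expMap_mem hr hz⟩ := by
  rw [hψ.untwist, hΓ.eq _ (puncturedPolydisk_subset r hz), ← Submodule.map_comp]
  rfl

/-- Griffiths horizontality of the sections `z ↦ frame Γ z x`, `x ∈ F^p_∞`. -/
lemma logForm_apply_mem (hΓ : 𝒱.IsPeriodLog ψ r Γ) (hψ : 𝒱.IsAdmissible ψ) (hr : r ≤ 1)
    {s : Fin n → ℂ} (hs : s ∈ puncturedPolydisk n r) (j : Fin n) {p : ℤ} {x : 𝒱.V}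
    (hx : x ∈ ψ p 0) : logForm Γ j s x ∈ ψ (p - 1) 0 := by
  obtain ⟨z, rfl⟩ := exists_expMap_eq fun j => (hs j).1
  have hsection : ∀ w : ↥(upperHalf n), ↑w ∈ expMap ⁻¹' puncturedPolydisk n r →
      frame Γ w x ∈ 𝒱.period p w := fun w hw => by
    rw [← hΓ.map_frame hψ hr hw]
    exact ⟨x, hx, rfl⟩
  have hderiv := 𝒱.hodge_horizontal p _ (isOpen_expMap_preimage_puncturedPolydisk r)
    (fun w hw => mem_upperHalf_of_expMap_mem hr hw) (fun w => frame Γ w x)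
    ((hΓ.isHol_frame hψ hr).linear (LinearMap.applyₗ x)) hsection
    ⟨z, mem_upperHalf_of_expMap_mem hr hs⟩ hs j _
    ((hΓ.hasPartial_frame hψ hr hs j).linear (LinearMap.applyₗ x))
  change _ ∈ 𝒱.period (p - 1) _ at hderiv
  rw [← hΓ.map_frame hψ hr hs (p - 1)] at hderiv
  obtain ⟨y, hy, hyx⟩ := hderiv
  have hinj := ((Module.End.isUnit_iff _).1 (hΓ.isUnit_frame hψ hr hs)).injective
  rw [hinj hyx] at hy
  exact (Submodule.smul_mem_iff _ (two_pi_I_mul_ne_zero hs j)).1 hy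

lemma logForm_mem_wp (hΓ : 𝒱.IsPeriodLog ψ r Γ) (hψ : 𝒱.IsAdmissible ψ) (hr : r ≤ 1)
    {s : Fin n → ℂ} (hs : s ∈ puncturedPolydisk n r) (j : Fin n) :
    logForm Γ j s ∈ 𝒱.wp (fun p => ψ p 0) (-1) :=
  mem_wp_of_map_hodge_le (hΓ.logForm_mem_qInf hψ hr (puncturedPolydisk_subset r hs) j)
    fun _ _ hx => hΓ.logForm_apply_mem hψ hr hs j hx

end IsPeriodLog

end VGPMHS

/-! ### The Higgs field -/

namespace VGPMHS

variable {n : ℕ} {𝒱 : VGPMHS.{u} n} {ψ : ℤ → (Fin n → ℂ) → Submodule ℂ 𝒱.V} {r : ℝ}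
  {Γ : (Fin n → ℂ) → Module.End ℂ 𝒱.V}

/-- `Γ_{-1}`, the part of degree `-1` of `Γ` with respect to the filtration `F_∞`. -/
noncomputable def gammaNegOne (Finf : ℤ → Submodule ℂ 𝒱.V)
    (Γ : (Fin n → ℂ) → Module.End ℂ 𝒱.V) (s : Fin n → ℂ) : Module.End ℂ 𝒱.V :=
  𝒱.negOneProj Finf (Γ s)

/-- `X_{-1}`, in the form `∑ z_j N_j + Γ_{-1}(e^{2πiz})`. -/
noncomputable def XNegOne (Finf : ℤ → Submodule ℂ 𝒱.V)
    (Γ : (Fin n → ℂ) → Module.End ℂ 𝒱.V) (z : Fin n → ℂ) : Module.End ℂ 𝒱.V :=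
  ∑ j, z j • 𝒱.N j + gammaNegOne Finf Γ (expMap z)

/-- The coefficient of `ds_j` in the Higgs field `Ω + ∂Γ_{-1}`. -/
noncomputable def higgsForm (Finf : ℤ → Submodule ℂ 𝒱.V)
    (Γ : (Fin n → ℂ) → Module.End ℂ 𝒱.V) (j : Fin n) (s : Fin n → ℂ) : Module.End ℂ 𝒱.V :=
  𝒱.Omega j s + partialDeriv j (gammaNegOne Finf Γ) s

namespace IsPeriodLog

lemma isHol_gammaNegOne (hΓ : 𝒱.IsPeriodLog ψ r Γ) (Finf : ℤ → Submodule ℂ 𝒱.V) :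
    IsHol (polydisk n r) (gammaNegOne Finf Γ) := hΓ.holomorphic.linear (𝒱.negOneProj Finf)

lemma hasPartial_gammaNegOne (hΓ : 𝒱.IsPeriodLog ψ r Γ) (Finf : ℤ → Submodule ℂ 𝒱.V)
    {s : Fin n → ℂ} (hs : s ∈ polydisk n r) (j : Fin n) :
    HasPartial j (gammaNegOne Finf Γ) s (partialDeriv j (gammaNegOne Finf Γ) s) :=
  (hΓ.isHol_gammaNegOne Finf).hasPartial (isOpen_polydisk r) hs j

lemma partialDeriv_gammaNegOne (hΓ : 𝒱.IsPeriodLog ψ r Γ) (Finf : ℤ → Submodule ℂ 𝒱.V)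
    {s : Fin n → ℂ} (hs : s ∈ polydisk n r) (j : Fin n) :
    partialDeriv j (gammaNegOne Finf Γ) s = 𝒱.negOneProj Finf (partialDeriv j Γ s) :=
  (hΓ.hasPartial_gammaNegOne Finf hs j).unique
    ((hΓ.holomorphic.hasPartial (isOpen_polydisk r) hs j).linear _)

lemma gammaNegOne_mem_wp (hΓ : 𝒱.IsPeriodLog ψ r Γ) {s : Fin n → ℂ} (hs : s ∈ polydisk n r) :
    gammaNegOne (fun p => ψ p 0) Γ s ∈ 𝒱.wp (fun p => ψ p 0) (-1) :=
  negOneProj_mem_wp (hΓ.mem s hs)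

lemma isComponent_gammaNegOne (hΓ : 𝒱.IsPeriodLog ψ r Γ) {s : Fin n → ℂ}
    (hs : s ∈ polydisk n r) :
    IsComponent (𝒱.UInf fun p => ψ p 0) (-1) (Γ s) (gammaNegOne (fun p => ψ p 0) Γ s) :=
  isComponent_negOneProj (hΓ.mem s hs)

lemma XNegOne_mem_wp (hΓ : 𝒱.IsPeriodLog ψ r Γ) (hψ : 𝒱.IsAdmissible ψ) {z : Fin n → ℂ}
    (hz : expMap z ∈ puncturedPolydisk n r) :
    XNegOne (fun p => ψ p 0) Γ z ∈ 𝒱.wp (fun p => ψ p 0) (-1) :=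
  Submodule.add_mem _ (hψ.sum_smul_N_mem_wp z)
    (hΓ.gammaNegOne_mem_wp (puncturedPolydisk_subset r hz))

lemma isComponent_XNegOne (hΓ : 𝒱.IsPeriodLog ψ r Γ) (hψ : 𝒱.IsAdmissible ψ) (hr : r ≤ 1)
    {z : Fin n → ℂ} (hz : expMap z ∈ puncturedPolydisk n r) :
    IsComponent (𝒱.UInf fun p => ψ p 0) (-1) (𝒱.X Γ z) (XNegOne (fun p => ψ p 0) Γ z) := by
  have hs := puncturedPolydisk_subset r hz
  have hlog : 𝒱.X Γ z - (∑ j, z j • 𝒱.N j + Γ (expMap z)) ∈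
      glBelow (𝒱.UInf fun p => ψ p 0) (-2) :=
    unipotentLog_exp_mul_exp_sub_mem_glBelow (qInf_le_glBelow (wp_le_qInf (hψ.sum_smul_N_mem_wp z)))
      (qInf_le_glBelow (hΓ.mem _ hs)) (hψ.isNilpotent_sum_smul_N z) (hΓ.isNilpotent hψ hr hs)
  refine isComponent_of_sub_mem_glBelow (c := -2) (by norm_num) (hΓ.XNegOne_mem_wp hψ hz).2 ?_
  have hsum := Submodule.add_mem _ hlog (sub_negOneProj_mem_glBelow (hΓ.mem _ hs))
  rwa [← sub_sub, sub_add_sub_cancel, sub_sub] at hsum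

lemma isHol_XNegOne (hΓ : 𝒱.IsPeriodLog ψ r Γ) (Finf : ℤ → Submodule ℂ 𝒱.V) :
    IsHol (expMap ⁻¹' puncturedPolydisk n r) (XNegOne Finf Γ) :=
  (IsHol.sum fun i _ => IsHol.smul_const (by fun_prop) (𝒱.N i)).add
    ((hΓ.isHol_gammaNegOne Finf).mono (puncturedPolydisk_subset r)).comp_expMap

lemma hasPartial_XNegOne (hΓ : 𝒱.IsPeriodLog ψ r Γ) (Finf : ℤ → Submodule ℂ 𝒱.V)
    {z : Fin n → ℂ} (hz : expMap z ∈ puncturedPolydisk n r) (j : Fin n) :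
    HasPartial j (XNegOne Finf Γ) z
      ((2 * Real.pi * Complex.I * expMap z j) • higgsForm Finf Γ j (expMap z)) := by
  rw [higgsForm, smul_add, smul_Omega hz]
  exact (hasPartial_sum_coord_smul j z 𝒱.N).add
    (hΓ.hasPartial_gammaNegOne Finf (puncturedPolydisk_subset r hz) j).comp_expMap

lemma isHol_higgsForm (hΓ : 𝒱.IsPeriodLog ψ r Γ) (Finf : ℤ → Submodule ℂ 𝒱.V) (j : Fin n) :
    IsHol (puncturedPolydisk n r) (higgsForm Finf Γ j) :=
  (isHol_Omega j).add (((hΓ.isHol_gammaNegOne Finf).partialDeriv (isOpen_polydisk r) j).mono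
    (puncturedPolydisk_subset r))

lemma logForm_eq_higgsForm (hΓ : 𝒱.IsPeriodLog ψ r Γ) (hψ : 𝒱.IsAdmissible ψ) (hr : r ≤ 1)
    (h : ∃ I, IsDeligneBigrading (fun p => ψ p 0) 𝒱.relW I) {s : Fin n → ℂ}
    (hs : s ∈ puncturedPolydisk n r) (j : Fin n) :
    logForm Γ j s = higgsForm (fun p => ψ p 0) Γ j s := by
  have hs' := puncturedPolydisk_subset r hs
  have hproj := glProj_eq_of_sub_mem_glBelow (isInternal_UInf h) (a := -1) (by norm_num)
    (hΓ.logForm_sub_mem hψ hr hs' j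
      (fun _ hα => commutator_mem_glBelow_neg_two (hΓ.mem s hs') (glBelow_mono (by norm_num) hα))
      fun _ hα => commutator_mem_glBelow_neg_two (hΓ.mem s hs') (qInf_le_glBelow hα))
  rwa [map_add, glProj_same _ (hΓ.logForm_mem_wp hψ hr hs j).2,
    glProj_same _ (hψ.Omega_mem_wp j s).2, ← negOneProj_eq h,
    ← hΓ.partialDeriv_gammaNegOne _ hs' j] at hproj

lemma commute_partialDeriv_XNegOne (hΓ : 𝒱.IsPeriodLog ψ r Γ) (hψ : 𝒱.IsAdmissible ψ)
    (hr : r ≤ 1) (h : ∃ I, IsDeligneBigrading (fun p => ψ p 0) 𝒱.relW I) {z : Fin n → ℂ}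
    (hz : expMap z ∈ puncturedPolydisk n r) (i j : Fin n) :
    Commute (partialDeriv i (XNegOne (fun p => ψ p 0) Γ) z)
      (partialDeriv j (XNegOne (fun p => ψ p 0) Γ) z) := by
  have hO := isOpen_expMap_preimage_puncturedPolydisk (n := n) r
  have hX := hΓ.isHol_XNegOne fun p => ψ p 0
  refine commute_of_hasPartial_mul hO (g := frame Γ) (hX.partialDeriv hO) (fun w hw k => ?_)
    (hΓ.isHol_frame hψ hr) hz (hΓ.isUnit_frame hψ hr hz) (partialDeriv_comm hX hO hz i j)
  rw [(hX.hasPartial hO hw k).unique (hΓ.hasPartial_XNegOne _ hw k),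
    ← hΓ.logForm_eq_higgsForm hψ hr h hw]
  exact hΓ.hasPartial_frame hψ hr hw k

lemma commute_higgsForm (hΓ : 𝒱.IsPeriodLog ψ r Γ) (hψ : 𝒱.IsAdmissible ψ) (hr : r ≤ 1)
    {s : Fin n → ℂ} (hs : s ∈ puncturedPolydisk n r) (i j : Fin n) :
    Commute (higgsForm (fun p => ψ p 0) Γ i s) (higgsForm (fun p => ψ p 0) Γ j s) := by
  by_cases h : ∃ I, IsDeligneBigrading (fun p => ψ p 0) 𝒱.relW I
  · obtain ⟨z, rfl⟩ := exists_expMap_eq fun j => (hs j).1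
    have hpartial := fun k => ((hΓ.isHol_XNegOne fun p => ψ p 0).hasPartial
      (isOpen_expMap_preimage_puncturedPolydisk r) hs k).unique (hΓ.hasPartial_XNegOne _ hs k)
    have hcomm := hΓ.commute_partialDeriv_XNegOne hψ hr h hs i j
    rw [hpartial, hpartial] at hcomm
    simpa only [inv_smul_smul₀ (two_pi_I_mul_ne_zero hs _)] using
      (hcomm.smul_left (2 * Real.pi * Complex.I * expMap z i)⁻¹).smul_right
        (2 * Real.pi * Complex.I * expMap z j)⁻¹
  · have hΩ : ∀ k, higgsForm (fun p => ψ p 0) Γ k s = 𝒱.Omega k s := fun k => by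
      rw [higgsForm, hΓ.partialDeriv_gammaNegOne _ (puncturedPolydisk_subset r hs) k, negOneProj,
        dif_neg h, LinearMap.zero_apply, add_zero]
    rw [hΩ, hΩ]
    exact ((hψ.commute_N i j).smul_left _).smul_right _

lemma isHiggsField_higgsForm (hΓ : 𝒱.IsPeriodLog ψ r Γ) (hψ : 𝒱.IsAdmissible ψ) (hr : r ≤ 1) :
    IsHiggsField (puncturedPolydisk n r) (higgsForm (fun p => ψ p 0) Γ) :=
  ⟨hΓ.isHol_higgsForm _, fun _ hs i j => sub_eq_zero.2 (hΓ.commute_higgsForm hψ hr hs i j).eq⟩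

end IsPeriodLog

end VGPMHS

theorem theorem6p13 {n : ℕ} (𝒱 : VGPMHS.{u} n)
    (ψ : ℤ → (Fin n → ℂ) → Submodule ℂ 𝒱.V) (hψ : 𝒱.IsAdmissible ψ)
    (r : ℝ) (hr0 : 0 < r) (hr1 : r ≤ 1)
    (Γ : (Fin n → ℂ) → Module.End ℂ 𝒱.V) (hΓ : 𝒱.IsPeriodLog ψ r Γ) :
    -- e^{-ad Γ} Ω + e^{-Γ} ∂e^Γ takes its values in ℘_{-1}
    (∀ s ∈ puncturedPolydisk n r, ∀ j, ∃ D : Module.End ℂ 𝒱.V,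
      HasPartial j (fun s => IsNilpotent.exp (Γ s)) s D ∧
      (IsNilpotent.exp (-adEnd (Γ s))) (𝒱.Omega j s) +
        IsNilpotent.exp (-Γ s) * D ∈ 𝒱.wp (fun p => ψ p 0) (-1)) ∧
    -- the ℘_{-1}-components of Γ and X
    ∃ Γ₁ X₁ : (Fin n → ℂ) → Module.End ℂ 𝒱.V,
      IsHol (polydisk n r) Γ₁ ∧
      (∀ s ∈ polydisk n r, Γ₁ s ∈ 𝒱.wp (fun p => ψ p 0) (-1) ∧
        IsComponent (𝒱.UInf fun p => ψ p 0) (-1) (Γ s) (Γ₁ s)) ∧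
      (∀ z, expMap z ∈ puncturedPolydisk n r → X₁ z ∈ 𝒱.wp (fun p => ψ p 0) (-1) ∧
        IsComponent (𝒱.UInf fun p => ψ p 0) (-1) (𝒱.X Γ z) (X₁ z)) ∧
      -- the 1-form Ω + ∂Γ_{-1} pulls back to ∂X_{-1} and is a Higgs field
      ∃ θ : Fin n → (Fin n → ℂ) → Module.End ℂ 𝒱.V,
        (∀ s ∈ puncturedPolydisk n r, ∀ j, ∃ D : Module.End ℂ 𝒱.V,
          HasPartial j Γ₁ s D ∧ θ j s = 𝒱.Omega j s + D) ∧
        (∀ z, expMap z ∈ puncturedPolydisk n r → ∀ j,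
          HasPartial j X₁ z ((2 * Real.pi * Complex.I * expMap z j) • θ j (expMap z))) ∧
        IsHiggsField (puncturedPolydisk n r) θ := by
  have hsub := puncturedPolydisk_subset (n := n) r
  refine ⟨fun s hs j => ?_, VGPMHS.gammaNegOne (fun p => ψ p 0) Γ,
    VGPMHS.XNegOne (fun p => ψ p 0) Γ, hΓ.isHol_gammaNegOne _, fun s hs => ?_, fun z hz => ?_,
    VGPMHS.higgsForm (fun p => ψ p 0) Γ, fun s hs j => ?_, fun z hz j => ?_, ?_⟩
  · exact ⟨_, (hΓ.isHol_exp hψ hr1).hasPartial (isOpen_polydisk r) (hsub hs) j,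
      hΓ.logForm_mem_wp hψ hr1 hs j⟩
  · exact ⟨hΓ.gammaNegOne_mem_wp hs, hΓ.isComponent_gammaNegOne hs⟩
  · exact ⟨hΓ.XNegOne_mem_wp hψ hz, hΓ.isComponent_XNegOne hψ hr1 hz⟩
  · exact ⟨_, hΓ.hasPartial_gammaNegOne _ (hsub hs) j, rfl⟩
  · exact hΓ.hasPartial_XNegOne _ hz j
  · exact hΓ.isHiggsField_higgsForm hψ hr1
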